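/- Let $\Omega\subset\mathbb R^3$ be a bounded open set with Lipschitz boundary. Let $\mathcal V$ be the set of divergence-free fields in $C_0^\infty(\Omega)^3$, let $H$ and $V$ be the closures of $\mathcal V$ in $L^2(\Omega)^3$ and in $H^1(\Omega)^3$, and let $V'$ be the dual of $V$. Write $|\cdot|$ for the $L^2$-norm, $((\phi,\psi))=\int_\Omega\nabla\phi:\nabla\psi$, $b(u,v,w)=\int_\Omega((u\cdot\nabla)v)\cdot w$ and $\|\phi\|_{H^1(\Omega)}^2=|\Omega|^{-1/3}|\phi|^2+|\nabla\phi|^2$. For $\nu>0$ and $f\in L^2(0,T;V')$ for all $T>0$, a weak solution of the Navier–Stokes equations with viscosity $\nu$ and force $f$ is a weakly continuous $u:[0,\infty)\to H$ such that, for all $T>0$, $u\in L^2(0,T;V)$, whose distributional time derivative satisfies $du/dt\in L^1_{\mathrm{loc}}((0,\infty);V')$, and such that for almost every $t>0$ $$\langle du/dt,\phi\rangle+\nu((u,\phi))+b(u,u,\phi)=\langle f,\phi\rangle\qquad\text{for all }\phi\in V .$$ Let $\gamma>0$ and $C_1>0$. There is a constant $C>0$, depending only on $\Omega,\gamma,C_1$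 (so independent of $\nu$, $f$, $u$, and also of $g,v,N,R_N$), such that the following holds for every $\nu>0$. Let $f,g\in L^2(0,T;V')$ for all $T>0$ satisfy $$\lim_{t\to\infty}\|f(t)-g(t)\|_{V'}=0,$$ and let $u,v$ be weak solutions with viscosity $\nu$ and forces $f$ and $g$, respectively. Assume that $v$ satisfies the strong energy inequality: for almost every $s>0$ and every $t\ge s$, $$\tfrac12|v(t)|^2+\nu\int_s^t|\nabla v|^2\,d\tau\le\tfrac12|v(s)|^2+\int_s^t\langle g,v\rangle\,d\tau .$$ Assume also that $$D:=\inf_{T>0}\Big\{\limsup_{t\to\infty}\frac1T\int_t^{t+T}\|\nabla u(s)\|_{L^\infty(\Omega)}\,ds\Big\}<\infty .$$ Let $V_N\subset L^2(\Omega)^3$ be a subspace of finite dimension $N$ and let $R_N:V\to V_N$ be a linear operator with $$\|\phi-R_N\phi\|_{L^2(\Omega)}\le C_1N^{-\gamma}\|\phi\|_{H^1(\Omega)}\quad\text{for all }\phi\in V,\qquad \lim_{t\to\infty}\|R_N(u(t)-v(t))\|_{L^2(\Omega)}=0 .$$ If $$N>C\left(\frac1\nu\,D\right)^{\frac1{2\gamma}},$$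 then $\lim_{t\to\infty}|u(t)-v(t)|=0$. (The limits in the hypotheses on $f-g$ and on $R_N(u-v)$, which are functions defined for almost every $t$, are essential limits; the limit in the conclusion is an ordinary one.) -/

import Mathlib

open Set Filter Topology MeasureTheory
open scoped ENNReal NNReal ContDiff

noncomputable section

namespace NSE

/-- Physical space. -/
abbrev E3 : Type := EuclideanSpace ℝ (Fin 3)

/-- Matrices with the Euclidean (Frobenius) norm; the entry `(i, j)` of a gradient is `∂ᵢ uⱼ`. -/
abbrev M33 : Type := EuclideanSpace ℝ (Fin 3 × Fin 3)

/-- Vector fields in `L²(Ω)`. -/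
abbrev L2 (Ω : Set E3) : Type := Lp E3 2 (volume.restrict Ω)

/-- Matrix fields in `L²(Ω)`. -/
abbrev L2Mat (Ω : Set E3) : Type := Lp M33 2 (volume.restrict Ω)

/-- Pairs `(φ, G)` of a vector field and a matrix field in `L²(Ω)`, with the Hilbert space structure
given by the norm `(‖φ‖² + ‖G‖²)^(1/2)`. -/
abbrev Pairs (Ω : Set E3) : Type := WithLp 2 (L2 Ω × L2Mat Ω)

/-- The set `Ω` has a (locally) Lipschitz boundary: near each boundary point, in suitable orthonormal
coordinates, `Ω` is the region strictly above the graph of a Lipschitz function. -/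
def HasLipschitzBoundary (Ω : Set E3) : Prop :=
  ∀ x ∈ frontier Ω, ∃ (e : E3 ≃ₗᵢ[ℝ] E3) (K : ℝ≥0) (ψ : EuclideanSpace ℝ (Fin 2) → ℝ),
    LipschitzWith K ψ ∧ ∀ᶠ y in 𝓝 x, (y ∈ Ω ↔ ψ (!₂[e y 0, e y 1]) < e y 2)

/-- The classical partial derivative `∂ᵢ φⱼ (x)`. -/
def partialDeriv (φ : E3 → E3) (i j : Fin 3) (x : E3) : ℝ :=
  (fderiv ℝ φ x (EuclideanSpace.single i 1)) j

/-- The classical gradient matrix of a vector field. -/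
def gradField (φ : E3 → E3) (x : E3) : M33 :=
  WithLp.toLp 2 (fun ij : Fin 3 × Fin 3 => partialDeriv φ ij.1 ij.2 x)

/-- Smooth divergence-free vector fields with compact support in `Ω`. -/
structure IsTestField (Ω : Set E3) (φ : E3 → E3) : Prop where
  smooth : ContDiff ℝ ∞ φ
  compactSupport : HasCompactSupport φ
  support_subset : tsupport φ ⊆ Ω
  div_free : ∀ x, ∑ i, partialDeriv φ i i x = 0

theorem IsTestField.zero (Ω : Set E3) : IsTestField Ω 0 where
  smooth := contDiff_const
  compactSupport := HasCompactSupport.zero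
  support_subset := by simp
  div_free := by intro x; simp [partialDeriv]

theorem IsTestField.partialDeriv_add {Ω : Set E3} {φ ψ : E3 → E3} (hφ : IsTestField Ω φ)
    (hψ : IsTestField Ω ψ) (i j : Fin 3) (x : E3) :
    partialDeriv (φ + ψ) i j x = partialDeriv φ i j x + partialDeriv ψ i j x := by
  have h1 : DifferentiableAt ℝ φ x := (hφ.smooth.differentiable (by simp)) x
  have h2 : DifferentiableAt ℝ ψ x := (hψ.smooth.differentiable (by simp)) x
  simp [partialDeriv, fderiv_add h1 h2]

theorem IsTestField.partialDeriv_smul {Ω : Set E3} {φ : E3 → E3} (hφ : IsTestField Ω φ)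
    (c : ℝ) (i j : Fin 3) (x : E3) :
    partialDeriv (c • φ) i j x = c * partialDeriv φ i j x := by
  have h1 : DifferentiableAt ℝ φ x := (hφ.smooth.differentiable (by simp)) x
  simp [partialDeriv, fderiv_const_smul h1]

theorem IsTestField.add {Ω : Set E3} {φ ψ : E3 → E3} (hφ : IsTestField Ω φ)
    (hψ : IsTestField Ω ψ) : IsTestField Ω (φ + ψ) where
  smooth := hφ.smooth.add hψ.smooth
  compactSupport := hφ.compactSupport.add hψ.compactSupport
  support_subset :=
    (tsupport_add φ ψ).trans (union_subset hφ.support_subset hψ.support_subset)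
  div_free := by
    intro x
    simp [hφ.partialDeriv_add hψ, Finset.sum_add_distrib, hφ.div_free x, hψ.div_free x]

theorem IsTestField.smul {Ω : Set E3} {φ : E3 → E3} (hφ : IsTestField Ω φ) (c : ℝ) :
    IsTestField Ω (c • φ) where
  smooth := contDiff_const.smul hφ.smooth
  compactSupport := hφ.compactSupport.smul_left (f := fun _ => c)
  support_subset := (closure_mono (Function.support_const_smul_subset c φ)).trans
    hφ.support_subset
  div_free := by
    intro x
    simp [hφ.partialDeriv_smul, ← Finset.mul_sum, hφ.div_free x]

/-- The test fields, each as the pair `(φ, ∇φ)`.  On such pairs the norm is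
the `H¹`-norm `(‖φ‖² + ‖∇φ‖²)^(1/2)`. -/
def testSpace (Ω : Set E3) : Submodule ℝ (Pairs Ω) where
  carrier := {p | ∃ φ : E3 → E3, IsTestField Ω φ ∧
    p.fst =ᵐ[volume.restrict Ω] φ ∧ p.snd =ᵐ[volume.restrict Ω] gradField φ}
  zero_mem' := by
    refine ⟨0, IsTestField.zero Ω, Lp.coeFn_zero _ _ _, (Lp.coeFn_zero _ _ _).trans ?_⟩
    refine Eventually.of_forall fun x => ?_
    ext ij
    simp [gradField, partialDeriv]
  add_mem' := by
    rintro p q ⟨φ, hφ, h1, h2⟩ ⟨ψ, hψ, h3, h4⟩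
    refine ⟨φ + ψ, hφ.add hψ, (Lp.coeFn_add p.fst q.fst).trans (h1.add h3),
      (Lp.coeFn_add p.snd q.snd).trans ((h2.add h4).trans ?_)⟩
    refine Eventually.of_forall fun x => ?_
    ext ij
    simp [gradField, hφ.partialDeriv_add hψ]
  smul_mem' := by
    rintro c p ⟨φ, hφ, h1, h2⟩
    refine ⟨c • φ, hφ.smul c, (Lp.coeFn_smul c p.fst).trans (h1.const_smul c),
      (Lp.coeFn_smul c p.snd).trans ((h2.const_smul c).trans ?_)⟩
    refine Eventually.of_forall fun x => ?_
    ext ij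
    simp [gradField, hφ.partialDeriv_smul]

/-- The closure of the test fields in `H¹`.  An element is a pair `(φ, ∇φ)`, where `∇φ` is the weak
gradient of `φ` (the relation "is the weak gradient of" is closed in `L² × L²`). -/
def closureV (Ω : Set E3) : Submodule ℝ (Pairs Ω) := (testSpace Ω).topologicalClosure

/-- The space `V` as a type.  Its norm is the full `H¹`-norm, which is equivalent on `V` to
`‖∇φ‖` when `Ω` is bounded. -/
def SpaceV (Ω : Set E3) : Type := closureV Ω

instance (Ω : Set E3) : NormedAddCommGroup (SpaceV Ω) :=
  inferInstanceAs (NormedAddCommGroup (closureV Ω))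

instance (Ω : Set E3) : InnerProductSpace ℝ (SpaceV Ω) :=
  inferInstanceAs (InnerProductSpace ℝ (closureV Ω))

instance (Ω : Set E3) : CompleteSpace (SpaceV Ω) :=
  (Submodule.isClosed_topologicalClosure (testSpace Ω)).completeSpace_coe

/-- The space `H`, the closure of the test fields in `L²`. -/
def SpaceH (Ω : Set E3) : Submodule ℝ (L2 Ω) :=
  ((testSpace Ω).map (WithLp.fstL 2 ℝ (L2 Ω) (L2Mat Ω)).toLinearMap).topologicalClosure

/-- The dual `V'` with its operator norm. -/
abbrev VDual (Ω : Set E3) : Type := StrongDual ℝ (SpaceV Ω)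

variable {Ω : Set E3}

/-- The underlying `L²` vector field of an element of `V`. -/
def fieldV : SpaceV Ω →L[ℝ] L2 Ω :=
  (WithLp.fstL 2 ℝ (L2 Ω) (L2Mat Ω)).comp (closureV Ω).subtypeL

/-- The weak gradient of an element of `V`. -/
def gradV : SpaceV Ω →L[ℝ] L2Mat Ω :=
  (WithLp.sndL 2 ℝ (L2 Ω) (L2Mat Ω)).comp (closureV Ω).subtypeL

/-- `‖φ‖²_{H¹} = |Ω|^{-1/3} ‖φ‖²_{L²} + ‖∇φ‖²_{L²}`. -/
def h1Norm (φ : SpaceV Ω) : ℝ :=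
  Real.sqrt ((volume Ω).toReal ^ (-(1 / 3) : ℝ) * ‖fieldV φ‖ ^ 2 + ‖gradV φ‖ ^ 2)

/-- The Dirichlet form `((φ, ψ)) = ∑ᵢⱼ ∫ ∂ᵢφⱼ ∂ᵢψⱼ`. -/
def dirichlet (φ ψ : SpaceV Ω) : ℝ := inner ℝ (gradV φ) (gradV ψ)

/-- The trilinear form `b(u, v, w) = ∫ ((u · ∇) v) · w`. -/
def trilinear (u v w : SpaceV Ω) : ℝ :=
  ∫ x in Ω, ∑ i, ∑ j, fieldV u x i * gradV v x (i, j) * fieldV w x j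

/-- `f ∈ L²(0, T; V')` for every finite `T`. -/
def IsForcing (f : ℝ → VDual Ω) : Prop :=
  ∀ T : ℝ, 0 < T → MemLp f 2 (volume.restrict (Ioc 0 T))

/-- `u'` belongs to `L¹_loc((0, ∞); V')` and is the distributional time derivative on `(0, ∞)` of
the `H`-valued function `u`, regarded as `V'`-valued through the `L²` pairing. -/
def IsTimeDeriv (u : ℝ → SpaceH Ω) (u' : ℝ → VDual Ω) : Prop :=
  LocallyIntegrableOn u' (Ioi 0) ∧
  ∀ η : ℝ → ℝ, ContDiff ℝ ∞ η → HasCompactSupport η → tsupport η ⊆ Ioi 0 → ∀ φ : SpaceV Ω,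
    ∫ t in Ioi (0 : ℝ), deriv η t * inner ℝ (u t : L2 Ω) (fieldV φ)
      = - ∫ t in Ioi (0 : ℝ), η t * u' t φ

/-- Weak solutions on `[0, ∞)` of the Navier–Stokes equations with viscosity `ν` and force `f`.
A solution is a function `u : [0, ∞) → H`, defined at every time (its initial value is `u 0`);
for almost every time its value lies in `V`, and `uV` is that `V`-valued function. -/
structure IsWeakSolution (ν : ℝ) (f : ℝ → VDual Ω) (u : ℝ → SpaceH Ω) (uV : ℝ → SpaceV Ω) :
    Prop where
  weaklyContinuous : ∀ h : SpaceH Ω, ContinuousOn (fun t => inner ℝ (u t) h) (Ici 0)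
  memL2V : ∀ T : ℝ, 0 < T → MemLp uV 2 (volume.restrict (Ioc 0 T))
  ae_eq : ∀ᵐ t ∂(volume.restrict (Ioi (0 : ℝ))), fieldV (uV t) = (u t : L2 Ω)
  equation : ∃ u' : ℝ → VDual Ω, IsTimeDeriv u u' ∧
    ∀ᵐ t ∂(volume.restrict (Ioi (0 : ℝ))), ∀ φ : SpaceV Ω,
      u' t φ + ν * dirichlet (uV t) φ + trilinear (uV t) (uV t) φ = f t φ

/-- The (strong) energy inequality, from almost every starting time `s` to every later time `t`. -/
def EnergyInequality (ν : ℝ) (f : ℝ → VDual Ω) (u : ℝ → SpaceH Ω) (uV : ℝ → SpaceV Ω) : Prop :=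
  ∀ᵐ s ∂(volume.restrict (Ioi (0 : ℝ))), ∀ t : ℝ, s ≤ t →
    ‖u t‖ ^ 2 / 2 + ν * ∫ τ in s..t, ‖gradV (uV τ)‖ ^ 2
      ≤ ‖u s‖ ^ 2 / 2 + ∫ τ in s..t, f τ (uV τ)

/-- `‖∇φ‖_{L^∞(Ω)}`, possibly infinite. -/
def gradSup (φ : SpaceV Ω) : ℝ≥0∞ := eLpNorm (gradV φ) ∞ (volume.restrict Ω)

/-- `inf_{T > 0} limsup_{t → ∞} (1/T) ∫_t^{t+T} ‖∇u(s)‖_{L^∞(Ω)} ds`, possibly infinite. -/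
def meanGradSup (uV : ℝ → SpaceV Ω) : ℝ≥0∞ :=
  ⨅ (T : ℝ) (_ : 0 < T),
    limsup (fun t : ℝ => ENNReal.ofReal (1 / T) * ∫⁻ s in Ioc t (t + T), gradSup (uV s)) atTop

/-- `lim_{t → ∞} a(t) = 0` for a function `a` that is determined for almost every `t` only. -/
def EssTendstoZero (a : ℝ → ℝ) : Prop :=
  Tendsto a (atTop ⊓ ae volume) (𝓝 0)

end NSE

end

open NSE

namespace NSE

/-! ### Translations and Steklov averages in time -/

section Time

variable {X : Type*} [NormedAddCommGroup X]

/-! Put `w = u - v`. Formally, `½ d/dt |w|² + ν|∇w|² + b(w,u,w) ≤ ⟨f - g, w⟩`, where `|b(w,u,w)| ≤ m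
|w|²` and `m(t) = ‖∇u(t)‖_∞`. The approximation property of `R_N` with Poincaré's inequality gives
`|w|² ≤ 2η²K|∇w|² + 2|R_N w|²`, where `η = C₁N^{-γ}`. One half of the dissipation in the inequality
for `|w|²` absorbs the force, the other half dominates `α|w|²` with `α = ν/(2η²K)`. So `d/dt |w|² +
(α - 2m)|w|²` is eventually at most an arbitrarily small constant. The lower bound on `N` says
exactly that `2D < α`; the coefficient `α - 2m` then has positive mean over long windows, and
Grönwall's inequality makes `|w|` tend to zero (`decay_of_mean`, `tendsto_norm_sub_of_determining`).

The delicate point is the energy inequality for `w`, since `v` is only a weak solution. It is one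
half of the energy equality for `u`, minus the product rule for `⟨u, v⟩`, plus the energy inequality
for `v` (`difference_energy`). The product rule (`Evolution.inner_sub_inner`) rests on antisymmetry
of `b`, which puts the gradient on `u`, and on a substitute for mollification in time. If the
increment of `Z` from `τ` to `τ'` is at most the integral over `σ ∈ (τ, τ']` of `Θ(σ,τ) + Θ(σ,τ')`,
with `Θ` small in the mean near the diagonal, then averaging over all pairs at distance `h` and
letting `h → 0` shows that `Z` is nonincreasing at Lebesgue points
(`AEPairs.antitone_of_diagSmall`). The same principle yields Grönwall's inequality for discontinuous
functions. These inequalities hold for almost all pairs of times; weak continuity recovers every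
time at the end (`norm_le_of_ae_norm_le`). -/

theorem tendsto_eLpNorm_translate_sub {p : ℝ≥0∞} [Fact (1 ≤ p)] (hp : p ≠ ⊤) {y : ℝ → X}
    (hy : MemLp y p volume) :
    Tendsto (fun r : ℝ => eLpNorm (fun τ => y (τ + r) - y τ) p volume) (𝓝 0) (𝓝 0) := by
  have : Fact (p ≠ ⊤) := ⟨hp⟩
  have hcont : Continuous fun r : ℝ => DomAddAct.mk r +ᵥ hy.toLp y := by
    have h1 : Continuous fun r : ℝ => DomAddAct.mk r := DomAddAct.continuous_mk
    exact h1.vadd continuous_const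
  have h2 : Tendsto (fun r : ℝ => ‖(DomAddAct.mk r +ᵥ hy.toLp y) - hy.toLp y‖ₑ) (𝓝 0) (𝓝 0) := by
    have h3 := (hcont.sub (continuous_const (y := hy.toLp y))).enorm.tendsto 0
    simpa using h3
  refine h2.congr fun r => ?_
  rw [DomAddAct.mk_vadd_toLp, ← MemLp.toLp_sub, Lp.enorm_toLp]
  refine eLpNorm_congr_ae (Eventually.of_forall fun τ => ?_)
  simp [add_comm]

/-- A kernel on the plane of times that is, in the mean, small near the diagonal. -/
structure DiagSmall (Θ : ℝ → ℝ → ℝ≥0∞) : Prop where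
  aemeasurable : AEMeasurable (fun p : ℝ × ℝ => Θ p.1 p.2) (volume.prod volume)
  aemeasurable_diag : ∀ r : ℝ, AEMeasurable fun τ => Θ (τ + r) τ
  tendsto : Tendsto (fun r : ℝ => ∫⁻ τ, Θ (τ + r) τ) (𝓝 0) (𝓝 0)

/-- Passes between a pair of times and the coordinates (time, lag), in which smallness near the
diagonal is expressed. -/
theorem measurePreserving_shear :
    MeasurePreserving (fun z : ℝ × ℝ => (z.1 + z.2, z.1)) (volume.prod volume)
      (volume.prod volume) :=
  Measure.measurePreserving_swap.comp (measurePreserving_prod_add (volume : Measure ℝ) volume)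

namespace DiagSmall

theorem aemeasurable_shear {Θ : ℝ → ℝ → ℝ≥0∞} (h : DiagSmall Θ) :
    AEMeasurable (fun z : ℝ × ℝ => Θ (z.1 + z.2) z.1) (volume.prod volume) :=
  h.aemeasurable.comp_quasiMeasurePreserving measurePreserving_shear.quasiMeasurePreserving

theorem add {Θ Ξ : ℝ → ℝ → ℝ≥0∞} (h : DiagSmall Θ) (k : DiagSmall Ξ) :
    DiagSmall fun σ τ => Θ σ τ + Ξ σ τ := by
  refine ⟨h.aemeasurable.add k.aemeasurable,
    fun r => (h.aemeasurable_diag r).add (k.aemeasurable_diag r), ?_⟩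
  have := h.tendsto.add k.tendsto
  rw [add_zero] at this
  exact this.congr fun r => (lintegral_add_left' (h.aemeasurable_diag r) _).symm

/-- Replace the lag `r` by `-r` and translate. This serves the kernels whose weight sits at the
integration time `σ` instead of an endpoint. -/
theorem swap {Θ : ℝ → ℝ → ℝ≥0∞} (h : DiagSmall Θ) : DiagSmall fun σ τ => Θ τ σ := by
  refine ⟨h.aemeasurable.comp_quasiMeasurePreserving
    Measure.measurePreserving_swap.quasiMeasurePreserving, fun r => ?_, ?_⟩
  · have := (h.aemeasurable_diag (-r)).comp_quasiMeasurePreserving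
      (measurePreserving_add_right volume r).quasiMeasurePreserving
    refine this.congr (Eventually.of_forall fun τ => ?_)
    simp
  · have h1 : Tendsto (fun r : ℝ => -r) (𝓝 0) (𝓝 0) := by
      simpa using (continuous_neg (G := ℝ)).tendsto 0
    refine (h.tendsto.comp h1).congr fun r => ?_
    have := lintegral_add_right_eq_self (μ := (volume : Measure ℝ)) (fun τ => Θ (τ + -r) τ) r
    simpa using this.symm

theorem aestronglyMeasurable_fst {y : ℝ → X} (hy : AEStronglyMeasurable y volume) :
    AEStronglyMeasurable (fun p : ℝ × ℝ => y p.1) (volume.prod volume) :=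
  hy.comp_quasiMeasurePreserving Measure.quasiMeasurePreserving_fst

theorem aestronglyMeasurable_snd {y : ℝ → X} (hy : AEStronglyMeasurable y volume) :
    AEStronglyMeasurable (fun p : ℝ × ℝ => y p.2) (volume.prod volume) :=
  hy.comp_quasiMeasurePreserving Measure.quasiMeasurePreserving_snd

theorem aestronglyMeasurable_shift {y : ℝ → X} (hy : AEStronglyMeasurable y volume) (r : ℝ) :
    AEStronglyMeasurable (fun τ => y (τ + r)) volume :=
  hy.comp_quasiMeasurePreserving (measurePreserving_add_right volume r).quasiMeasurePreserving

theorem of_integrable {y : ℝ → X} (hy : Integrable y) : DiagSmall fun σ τ => ‖y σ - y τ‖ₑ := by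
  have hm := hy.aestronglyMeasurable
  refine ⟨((aestronglyMeasurable_fst hm).sub (aestronglyMeasurable_snd hm)).enorm,
    fun r => ((aestronglyMeasurable_shift hm r).sub hm).enorm, ?_⟩
  have := tendsto_eLpNorm_translate_sub (p := 1) (by simp) (memLp_one_iff_integrable.2 hy)
  simpa only [eLpNorm_one_eq_lintegral_enorm] using this

variable {Y : Type*} [NormedAddCommGroup Y]

/-- Hölder's inequality and continuity of translations in `L²`. -/
theorem of_memLp_two {a : ℝ → Y} {y : ℝ → X} (ha : MemLp a 2 volume) (hy : MemLp y 2 volume) :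
    DiagSmall fun σ τ => ‖a τ‖ₑ * ‖y σ - y τ‖ₑ := by
  have hm := hy.aestronglyMeasurable
  have hd := fun r => (aestronglyMeasurable_shift hm r).sub hm
  refine ⟨(aestronglyMeasurable_snd ha.1).enorm.mul
    ((aestronglyMeasurable_fst hm).sub (aestronglyMeasurable_snd hm)).enorm,
    fun r => ha.1.enorm.mul (hd r).enorm, ?_⟩
  have h0 := tendsto_eLpNorm_translate_sub (p := 2) (by simp) hy
  have h1 : Tendsto (fun r : ℝ => eLpNorm a 2 volume *
      eLpNorm (fun τ => y (τ + r) - y τ) 2 volume) (𝓝 0) (𝓝 0) := by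
    simpa using ENNReal.Tendsto.const_mul h0 (Or.inr ha.2.ne)
  refine tendsto_of_tendsto_of_tendsto_of_le_of_le tendsto_const_nhds h1 (fun _ => zero_le)
    fun r => ?_
  have h2 := ENNReal.lintegral_mul_le_Lp_mul_Lq volume Real.HolderConjugate.two_two
    ha.1.enorm (hd r).enorm
  simpa [eLpNorm_eq_lintegral_rpow_enorm_toReal] using h2

/-- Translations are not continuous in `L^∞`, so the bounded factor cannot be treated alone. Writing
the weighted difference as the translation difference of `m y` minus that of `m`, the latter times a
bounded function, leaves only `L¹` translations. -/
theorem of_bounded [NormedSpace ℝ X] {m : ℝ → ℝ} {y : ℝ → X} {C : ℝ} (hm : Integrable m)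
    (hy : AEStronglyMeasurable y volume) (hC : ∀ τ, ‖y τ‖ ≤ C) :
    DiagSmall fun σ τ => ‖m τ‖ₑ * ‖y σ - y τ‖ₑ := by
  have hmy : Integrable fun τ => m τ • y τ :=
    hm.smul_bdd C hy (Eventually.of_forall hC)
  have hd := fun r => (aestronglyMeasurable_shift hy r).sub hy
  have h1 := of_integrable hmy
  have h2 := of_integrable hm
  refine ⟨(aestronglyMeasurable_snd hm.1).enorm.mul
    ((aestronglyMeasurable_fst hy).sub (aestronglyMeasurable_snd hy)).enorm,
    fun r => hm.1.enorm.mul (hd r).enorm, ?_⟩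
  have h3 : Tendsto (fun r : ℝ => (∫⁻ τ, ‖m (τ + r) • y (τ + r) - m τ • y τ‖ₑ) +
      (∫⁻ τ, ‖m (τ + r) - m τ‖ₑ) * ENNReal.ofReal C) (𝓝 0) (𝓝 0) := by
    simpa using h1.tendsto.add (ENNReal.Tendsto.mul_const h2.tendsto (Or.inr ENNReal.ofReal_ne_top))
  refine tendsto_of_tendsto_of_tendsto_of_le_of_le tendsto_const_nhds h3 (fun _ => zero_le)
    fun r => ?_
  dsimp only
  rw [← lintegral_mul_const' _ _ ENNReal.ofReal_ne_top, ← lintegral_add_left' (h1.2 r)]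
  refine lintegral_mono fun τ => ?_
  have h4 : m τ • (y (τ + r) - y τ) =
      (m (τ + r) • y (τ + r) - m τ • y τ) - (m (τ + r) - m τ) • y (τ + r) := by
    module
  calc ‖m τ‖ₑ * ‖y (τ + r) - y τ‖ₑ = ‖m τ • (y (τ + r) - y τ)‖ₑ := (enorm_smul _ _).symm
    _ ≤ ‖m (τ + r) • y (τ + r) - m τ • y τ‖ₑ + ‖(m (τ + r) - m τ) • y (τ + r)‖ₑ := by
      rw [h4]; exact enorm_sub_le
    _ ≤ _ := by
      gcongr
      rw [enorm_smul]
      gcongr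
      rw [← ofReal_norm]
      exact ENNReal.ofReal_le_ofReal (hC _)

/-- The mean of the kernel over the pairs of times whose distance is at most `h`. -/
theorem exists_lintegral_le {Θ : ℝ → ℝ → ℝ≥0∞} (hΘ : DiagSmall Θ) {ε : ℝ} (hε : 0 < ε) :
    ∃ δ > 0, ∀ h, 0 < h → h < δ →
      ∫⁻ τ, ∫⁻ σ in Ioc τ (τ + h), Θ σ τ + Θ σ (τ + h) ≤ ENNReal.ofReal (ε * h) := by
  have hε' : (0 : ℝ≥0∞) < ENNReal.ofReal (ε / 2) := by simpa using hε
  obtain ⟨δ, hδ, H⟩ := Metric.eventually_nhds_iff.1 (hΘ.tendsto.eventually_le_const hε')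
  refine ⟨δ, hδ, fun h h0 hh => ?_⟩
  -- By Tonelli, the average over lags of a quantity that is at most `ε / 2` for each lag.
  have key : ∀ a b : ℝ, a ≤ b → -δ < a → b < δ →
      ∫⁻ τ, ∫⁻ r in Ioc a b, Θ (τ + r) τ ≤ ENNReal.ofReal (ε / 2 * (b - a)) := by
    intro a b hab ha hb
    rw [lintegral_lintegral_swap]
    · calc ∫⁻ r in Ioc a b, ∫⁻ τ, Θ (τ + r) τ
          ≤ ∫⁻ r in Ioc a b, ENNReal.ofReal (ε / 2) := by
            refine setLIntegral_mono measurable_const fun r hr => H ?_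
            rw [Real.dist_eq, sub_zero, abs_lt]
            exact ⟨ha.trans hr.1, hr.2.trans_lt hb⟩
        _ = _ := by
            rw [setLIntegral_const, Real.volume_Ioc, ← ENNReal.ofReal_mul (by positivity)]
    · refine (hΘ.aemeasurable_shear).mono_ac ?_
      exact Measure.AbsolutelyContinuous.rfl.prod Measure.absolutelyContinuous_restrict
  have shift : ∀ (g : ℝ → ℝ≥0∞) (a b τ : ℝ),
      ∫⁻ σ in Ioc (τ + a) (τ + b), g σ = ∫⁻ r in Ioc a b, g (τ + r) := by
    intro g a b τ
    rw [← lintegral_indicator measurableSet_Ioc, ← lintegral_indicator measurableSet_Ioc,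
      ← lintegral_add_left_eq_self _ τ]
    refine lintegral_congr fun r => ?_
    simp [indicator]
  have e1 : ∫⁻ τ, ∫⁻ σ in Ioc τ (τ + h), Θ σ τ ≤ ENNReal.ofReal (ε / 2 * h) := by
    have := key 0 h h0.le (by linarith) hh
    simp_rw [← fun τ => shift (fun σ => Θ σ τ) 0 h τ] at this
    simpa using this
  -- Seen from the right endpoint `τ + h`, the lags run through `(-h, 0]`.
  have e2 : ∫⁻ τ, ∫⁻ σ in Ioc τ (τ + h), Θ σ (τ + h) ≤ ENNReal.ofReal (ε / 2 * h) := by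
    have := key (-h) 0 (by linarith) (by linarith) hδ
    simp_rw [← fun τ => shift (fun σ => Θ σ τ) (-h) 0 τ] at this
    rw [← lintegral_add_right_eq_self _ h] at this
    simpa using this
  have hmeas : ∀ᵐ τ : ℝ, AEMeasurable (fun σ => Θ σ τ) := by
    have := Measure.ae_ae_of_ae_prod (μ := (volume : Measure ℝ)) (ν := (volume : Measure ℝ))
      hΘ.swap.aemeasurable.ae_eq_mk
    filter_upwards [this] with τ hτ
    exact ⟨_, hΘ.swap.aemeasurable.measurable_mk.comp measurable_prodMk_left, hτ⟩
  calc _ = ∫⁻ τ, ((∫⁻ σ in Ioc τ (τ + h), Θ σ τ) + ∫⁻ σ in Ioc τ (τ + h), Θ σ (τ + h)) := by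
        refine lintegral_congr_ae ?_
        filter_upwards [hmeas] with τ hτ
        exact lintegral_add_left' hτ.restrict _
    _ = (∫⁻ τ, ∫⁻ σ in Ioc τ (τ + h), Θ σ τ) + ∫⁻ τ, ∫⁻ σ in Ioc τ (τ + h), Θ σ (τ + h) := by
        refine lintegral_add_left' ?_ _
        have h1 : AEMeasurable (fun z : ℝ × ℝ => Θ (z.1 + z.2) z.1)
            ((volume : Measure ℝ).prod (volume.restrict (Ioc 0 h))) :=
          (hΘ.aemeasurable_shear).mono_ac
            (Measure.AbsolutelyContinuous.rfl.prod Measure.absolutelyContinuous_restrict)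
        refine h1.lintegral_prod_right'.congr (Eventually.of_forall fun τ => ?_)
        simpa using (shift (fun σ => Θ σ τ) 0 h τ).symm
    _ ≤ ENNReal.ofReal (ε / 2 * h) + ENNReal.ofReal (ε / 2 * h) := add_le_add e1 e2
    _ = _ := by
        rw [← ENNReal.ofReal_add (by positivity) (by positivity)]
        congr 1; ring

end DiagSmall

end Time

/-! ### Inequalities between almost all pairs of times -/

/-- `R s t` holds for all `s < t` in `(c, d)` outside a null set of times. -/
def AEPairs (c d : ℝ) (R : ℝ → ℝ → Prop) : Prop :=
  ∃ p : ℝ → Prop, (∀ᵐ τ, p τ) ∧ ∀ s, p s → ∀ t, p t → c < s → s < t → t < d → R s t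

namespace AEPairs

theorem mono {c d : ℝ} {R R' : ℝ → ℝ → Prop} (h : AEPairs c d R)
    (H : ∀ s t, c < s → s < t → t < d → R s t → R' s t) : AEPairs c d R' := by
  obtain ⟨S, hS, h⟩ := h
  exact ⟨S, hS, fun s hs t ht h1 h2 h3 => H s t h1 h2 h3 (h s hs t ht h1 h2 h3)⟩

theorem and {c d : ℝ} {R R' : ℝ → ℝ → Prop} (h : AEPairs c d R) (h' : AEPairs c d R') :
    AEPairs c d fun s t => R s t ∧ R' s t := by
  obtain ⟨S, hS, h⟩ := h
  obtain ⟨S', hS', h'⟩ := h'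
  exact ⟨_, hS.and hS', fun s hs t ht h1 h2 h3 =>
    ⟨h s hs.1 t ht.1 h1 h2 h3, h' s hs.2 t ht.2 h1 h2 h3⟩⟩

theorem of_forall_nat {c : ℝ} {R : ℝ → ℝ → Prop} (h : ∀ n : ℕ, AEPairs c n R) (d : ℝ) :
    AEPairs c d R := by
  choose S hS H using h
  refine ⟨fun s => ∀ n, S n s, ae_all_iff.2 hS, fun s hs t ht h1 h2 _ => ?_⟩
  obtain ⟨n, hn⟩ := exists_nat_gt t
  exact H n s (hs n) t (ht n) h1 h2 hn

theorem ae_ae {c d : ℝ} {R : ℝ → ℝ → Prop} (h : AEPairs c d R) :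
    ∀ᵐ s, c < s → ∀ᵐ t, s < t → t < d → R s t := by
  obtain ⟨S, hS, h⟩ := h
  filter_upwards [hS] with s hs hcs
  filter_upwards [hS] with t ht hst htd using h s hs t ht hcs hst htd

/-- A function whose upper increments are controlled by a kernel that is small near the diagonal
is almost everywhere nonincreasing. -/
theorem antitone_of_diagSmall {c d : ℝ} {Z : ℝ → ℝ} {Θ : ℝ → ℝ → ℝ≥0∞} (hΘ : DiagSmall Θ)
    (hZ : IntegrableOn Z (Ioo c d))
    (H : AEPairs c d fun τ τ' => ENNReal.ofReal (Z τ' - Z τ) ≤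
      ∫⁻ σ in Ioc τ τ', Θ σ τ + Θ σ τ') :
    AEPairs c d fun s t => Z t ≤ Z s := by
  rcases le_or_gt d c with hcd | hcd
  · exact ⟨fun _ => True, by simp, fun s _ t _ h1 h2 h3 => by linarith⟩
  have hint : ∀ a b, c ≤ a → a ≤ b → b ≤ d → IntervalIntegrable Z volume a b := by
    intro a b ha hab hb
    rw [intervalIntegrable_iff_integrableOn_Ioo_of_le hab]
    exact hZ.mono_set (Ioo_subset_Ioo ha hb)
  obtain ⟨S, hS, H⟩ := H
  -- The good times are the Lebesgue points of `Z`, where its Steklov averages converge to its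
  -- value.
  have hD := (hint c d le_rfl hcd.le le_rfl).ae_hasDerivAt_integral
  refine ⟨_, hD, fun s hs t ht hcs hst htd => ?_⟩
  rw [uIcc_of_le hcd.le] at hs ht
  have hs' := hs ⟨hcs.le, (hst.trans htd).le⟩ s ⟨hcs.le, (hst.trans htd).le⟩
  have ht' := ht ⟨(hcs.trans hst).le, htd.le⟩ t ⟨(hcs.trans hst).le, htd.le⟩
  have hs2 := hs'.tendsto_slope_zero_right
  have ht2 := ht'.tendsto_slope_zero_right
  refine le_of_sub_nonpos (le_of_forall_pos_le_add fun ε hε => ?_)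
  obtain ⟨δ, hδ, hΘδ⟩ := hΘ.exists_lintegral_le hε
  refine le_of_tendsto (ht2.sub hs2) ?_
  have hev : ∀ᶠ h in 𝓝[>] (0 : ℝ), h < min δ (min (d - t) (t - s)) :=
    nhdsWithin_le_nhds (eventually_lt_nhds (by simp [hδ, htd, hst]))
  filter_upwards [hev, self_mem_nhdsWithin] with h hh h0
  rw [mem_Ioi] at h0
  simp only [lt_min_iff] at hh
  obtain ⟨hhδ, hhd, hhs⟩ := hh
  simp only [intervalIntegral.integral_same, sub_zero, smul_eq_mul]
  -- The difference of two Steklov averages is an average of increments of length `h`, to which the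
  -- hypothesis applies.
  have e1 : (∫ τ in t..t + h, Z τ) - ∫ τ in s..s + h, Z τ = ∫ τ in s..t, (Z (τ + h) - Z τ) := by
    rw [intervalIntegral.integral_sub, intervalIntegral.integral_comp_add_right]
    · have := intervalIntegral.integral_interval_sub_interval_comm'
        (hint s t hcs.le hst.le htd.le) (hint (s + h) (t + h) (by linarith) (by linarith)
        (by linarith)) ?_
      · have e2 := intervalIntegral.integral_add_adjacent_intervals
          (hint s (s + h) (by linarith) (by linarith) (by linarith))
          (hint (s + h) (t + h) (by linarith) (by linarith) (by linarith))
        have e3 := intervalIntegral.integral_add_adjacent_intervals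
          (hint s t (by linarith) (by linarith) (by linarith))
          (hint t (t + h) (by linarith) (by linarith) (by linarith))
        linarith
      · exact hint s (s + h) (by linarith) (by linarith) (by linarith)
    · have := (hint (s + h) (t + h) (by linarith) (by linarith) (by linarith)).comp_add_right h
      simpa using this
    · exact hint s t hcs.le hst.le htd.le
  have e4 : ∫ τ in s..t, (Z (τ + h) - Z τ) ≤ ε * h := by
    rw [intervalIntegral.integral_of_le hst.le]
    have hle : ∫⁻ τ in Ioc s t, ENNReal.ofReal (Z (τ + h) - Z τ) ≤ ENNReal.ofReal (ε * h) := by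
      refine le_trans ?_ (hΘδ h h0 hhδ)
      refine le_trans ?_ (setLIntegral_le_lintegral (Ioc s t) _)
      refine setLIntegral_mono_ae' measurableSet_Ioc ?_
      have hSh : ∀ᵐ τ, S (τ + h) :=
        (measurePreserving_add_right volume h).quasiMeasurePreserving.ae hS
      filter_upwards [hS, hSh] with τ h1 h2 hτ
      exact H τ h1 _ h2 (hcs.trans hτ.1) (by linarith) (by linarith [hτ.2])
    -- Only the positive part of the increments is controlled. In the nonintegrable case the
    -- integral is zero by convention, and the bound is trivial.
    by_cases hi : Integrable (fun τ => Z (τ + h) - Z τ) (volume.restrict (Ioc s t))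
    · rw [integral_eq_lintegral_pos_part_sub_lintegral_neg_part hi]
      refine (sub_le_self _ ENNReal.toReal_nonneg).trans ?_
      exact ENNReal.toReal_le_of_le_ofReal (by positivity) hle
    · rw [integral_undef hi]; positivity
  rw [← mul_sub, e1]
  calc h⁻¹ * ∫ τ in s..t, (Z (τ + h) - Z τ) ≤ h⁻¹ * (ε * h) := by gcongr
    _ = 0 + ε := by field_simp; ring

end AEPairs

/-! ### Grönwall's inequality for discontinuous functions. -/

theorem ofReal_le_setLIntegral_of_le_abs_integral {s t x : ℝ} {G : ℝ → ℝ} {Ξ : ℝ → ℝ≥0∞}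
    (hst : s ≤ t) (hx : x ≤ |∫ σ in s..t, G σ|) (hG : ∀ᵐ σ, σ ∈ Ioc s t → ‖G σ‖ₑ ≤ Ξ σ) :
    ENNReal.ofReal x ≤ ∫⁻ σ in Ioc s t, Ξ σ := by
  calc ENNReal.ofReal x ≤ ENNReal.ofReal ‖∫ σ in Ioc s t, G σ‖ := by
        rw [intervalIntegral.integral_of_le hst] at hx
        exact ENNReal.ofReal_le_ofReal hx
    _ = ‖∫ σ in Ioc s t, G σ‖ₑ := ofReal_norm _
    _ ≤ ∫⁻ σ in Ioc s t, ‖G σ‖ₑ := enorm_integral_le_lintegral_enorm _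
    _ ≤ _ := setLIntegral_mono_ae' measurableSet_Ioc hG

theorem enorm_le_mul_enorm {E F G : Type*} [NormedAddCommGroup E] [NormedAddCommGroup F]
    [NormedAddCommGroup G] {x : E} {y : F} {z : G} (h : ‖x‖ ≤ ‖y‖ * ‖z‖) :
    ‖x‖ₑ ≤ ‖y‖ₑ * ‖z‖ₑ := by
  rw [← ofReal_norm, ← ofReal_norm, ← ofReal_norm, ← ENNReal.ofReal_mul (norm_nonneg _)]
  exact ENNReal.ofReal_le_ofReal h

theorem intervalIntegrable_of_integrableOn_Ioo {E : Type*} [NormedAddCommGroup E] {c d : ℝ}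
    {f : ℝ → E} (hf : IntegrableOn f (Ioo c d)) {a b : ℝ} (ha : c ≤ a) (hab : a ≤ b) (hb : b ≤ d) :
    IntervalIntegrable f volume a b := by
  rw [intervalIntegrable_iff_integrableOn_Ioo_of_le hab]
  exact hf.mono_set (Ioo_subset_Ioo ha hb)

theorem norm_indicator_le_of_forall {E : Type*} [NormedAddCommGroup E] {S : Set ℝ} {f : ℝ → E}
    {C : ℝ} (hC : 0 ≤ C) (h : ∀ τ ∈ S, ‖f τ‖ ≤ C) (τ : ℝ) : ‖S.indicator f τ‖ ≤ C := by
  by_cases hτ : τ ∈ S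
  · simpa [hτ] using h τ hτ
  · simpa [hτ] using hC

/-- Grönwall's inequality for discontinuous functions and a coefficient without sign. -/
theorem AEPairs.gronwall {c d ε Y : ℝ} {y a : ℝ → ℝ} (ha : IntegrableOn a (Ioo c d))
    (hy : AEStronglyMeasurable y (volume.restrict (Ioo c d)))
    (hY : ∀ τ ∈ Ioo c d, 0 ≤ y τ ∧ y τ ≤ Y)
    (H : AEPairs c d fun s t => y t ≤ y s + ∫ τ in s..t, (ε - a τ * y τ)) :
    AEPairs c d fun s t => y t * Real.exp (∫ x in c..t, a x) ≤
      y s * Real.exp (∫ x in c..s, a x) + ε * ∫ τ in s..t, Real.exp (∫ x in c..τ, a x) := by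
  rcases le_or_gt d c with hcd | hcd
  · exact ⟨fun _ => True, by simp, fun s _ t _ h1 h2 h3 => by linarith⟩
  set A : ℝ → ℝ := fun τ => ∫ x in c..τ, a x with hA
  have hI {a' b' : ℝ} (h1 : c ≤ a') (h2 : a' ≤ b') (h3 : b' ≤ d) :
      IntervalIntegrable a volume a' b' := intervalIntegrable_of_integrableOn_Ioo ha h1 h2 h3
  have hAc : ContinuousOn A (Icc c d) := by
    have := intervalIntegral.continuousOn_primitive_interval (μ := volume) (f := a) (a := c) (b := d)
      (by rw [uIcc_of_le hcd.le, integrableOn_Icc_iff_integrableOn_Ioo]; exact ha)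
    rwa [uIcc_of_le hcd.le] at this
  set e : ℝ → ℝ := fun τ => Real.exp (A τ) with he
  have hec : ContinuousOn e (Icc c d) := hAc.rexp
  obtain ⟨E, hE⟩ := (isCompact_Icc.image_of_continuousOn hec).bddAbove
  have hE' : ∀ τ ∈ Icc c d, e τ ≤ E := fun τ hτ => hE (mem_image_of_mem _ hτ)
  have hE0 : 0 ≤ E := (Real.exp_nonneg _).trans (hE' c (left_mem_Icc.2 hcd.le))
  have hY0 : 0 ≤ Y := by
    obtain ⟨τ, hτ⟩ := nonempty_Ioo.2 hcd
    exact (hY τ hτ).1.trans (hY τ hτ).2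
  have heI : IntegrableOn e (Ioo c d) :=
    (hec.integrableOn_Icc (μ := volume)).mono_set Ioo_subset_Icc_self
  have heI' {a' b' : ℝ} (h1 : c ≤ a') (h2 : a' ≤ b') (h3 : b' ≤ d) :
      IntervalIntegrable e volume a' b' := intervalIntegrable_of_integrableOn_Ioo heI h1 h2 h3
  have hyI : IntegrableOn y (Ioo c d) := by
    refine Integrable.of_bound hy Y ?_
    refine (ae_restrict_iff' measurableSet_Ioo).2 (Eventually.of_forall fun τ hτ => ?_)
    rw [Real.norm_of_nonneg (hY τ hτ).1]; exact (hY τ hτ).2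
  have hayI : IntegrableOn (fun τ => a τ * y τ) (Ioo c d) := by
    refine Integrable.mul_bdd (c := Y) ha hy ?_
    refine (ae_restrict_iff' measurableSet_Ioo).2 (Eventually.of_forall fun τ hτ => ?_)
    rw [Real.norm_of_nonneg (hY τ hτ).1]; exact (hY τ hτ).2
  have heyI : IntegrableOn (fun τ => y τ * e τ) (Ioo c d) := by
    refine Integrable.mul_bdd (c := E) hyI heI.1 ?_
    refine (ae_restrict_iff' measurableSet_Ioo).2 (Eventually.of_forall fun τ hτ => ?_)
    rw [Real.norm_of_nonneg (Real.exp_nonneg _)]; exact hE' τ (Ioo_subset_Icc_self hτ)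
  set I := Ioo c d with hIdef
  -- With `e = exp ∫ a`, the aim is that `y e - ε ∫ e` is nonincreasing. The first kernel pays for
  -- freezing `y` at the left endpoint, the second for freezing `e` at the right endpoint.
  have hΘ1 : DiagSmall fun σ τ => ‖E * I.indicator a σ‖ₑ * ‖I.indicator y τ - I.indicator y σ‖ₑ :=
    (DiagSmall.of_bounded (C := Y) ((ha.integrable_indicator measurableSet_Ioo).const_mul E)
      ((aestronglyMeasurable_indicator_iff measurableSet_Ioo).2 hy)
      (norm_indicator_le_of_forall hY0 fun τ hτ => by
        rw [Real.norm_of_nonneg (hY τ hτ).1]; exact (hY τ hτ).2)).swap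
  have hΘ2 : DiagSmall fun σ τ => ‖ε * I.indicator e σ - ε * I.indicator e τ‖ₑ :=
    DiagSmall.of_integrable ((heI.integrable_indicator measurableSet_Ioo).const_mul ε)
  have hZ : IntegrableOn (fun τ => y τ * e τ - ε * ∫ x in c..τ, e x) (Ioo c d) := by
    refine heyI.sub (Integrable.const_mul ?_ ε)
    have := intervalIntegral.continuousOn_primitive_interval (μ := volume) (f := e) (a := c) (b := d)
      (by rw [uIcc_of_le hcd.le, integrableOn_Icc_iff_integrableOn_Ioo]; exact heI)
    rw [uIcc_of_le hcd.le] at this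
    exact (this.integrableOn_Icc (μ := volume)).mono_set Ioo_subset_Icc_self
  have main := AEPairs.antitone_of_diagSmall (hΘ1.add hΘ2) hZ (H.mono fun τ τ' hτ hττ' hτ' h => by
    refine ofReal_le_setLIntegral_of_le_abs_integral (G := fun σ =>
      a σ * (y τ - y σ) * e τ' + (ε * e τ' - ε * e σ)) hττ'.le (le_trans ?_ (le_abs_self _)) ?_
    · have i1 := hI hτ.le hττ'.le hτ'.le
      have i2 := intervalIntegrable_of_integrableOn_Ioo hayI hτ.le hττ'.le hτ'.le
      have i3 := heI' hτ.le hττ'.le hτ'.le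
      have s1 : A τ' - A τ = ∫ σ in τ..τ', a σ :=
        intervalIntegral.integral_interval_sub_left (hI le_rfl (hτ.trans hττ').le hτ'.le)
          (hI le_rfl hτ.le (hττ'.trans hτ').le)
      have s2 : (∫ σ in c..τ', e σ) - ∫ σ in c..τ, e σ = ∫ σ in τ..τ', e σ :=
        intervalIntegral.integral_interval_sub_left (heI' le_rfl (hτ.trans hττ').le hτ'.le)
          (heI' le_rfl hτ.le (hττ'.trans hτ').le)
      have s3 : (∫ σ in τ..τ', (a σ * (y τ - y σ) * e τ' + (ε * e τ' - ε * e σ))) =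
          e τ' * (y τ * (∫ σ in τ..τ', a σ) + ∫ σ in τ..τ', (ε - a σ * y σ))
            - ε * ∫ σ in τ..τ', e σ := by
        rw [intervalIntegral.integral_sub intervalIntegrable_const i2]
        have : ∀ σ, a σ * (y τ - y σ) * e τ' + (ε * e τ' - ε * e σ) =
            e τ' * (y τ * a σ + (ε - a σ * y σ)) - ε * e σ := fun σ => by ring
        simp_rw [this]
        rw [intervalIntegral.integral_sub, intervalIntegral.integral_const_mul,
          intervalIntegral.integral_const_mul, intervalIntegral.integral_add,
          intervalIntegral.integral_const_mul, intervalIntegral.integral_sub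
          intervalIntegrable_const i2]
        · exact i1.const_mul _
        · exact intervalIntegrable_const.sub i2
        · exact ((i1.const_mul _).add (intervalIntegrable_const.sub i2)).const_mul _
        · exact i3.const_mul _
      rw [s3, ← s1, ← s2]
      -- Convexity of the exponential; multiplied by `y τ ≥ 0` below, it needs no sign of `a`.
      have s4 : e τ' - e τ ≤ e τ' * (A τ' - A τ) := by
        have h1 := Real.add_one_le_exp (A τ - A τ')
        have h2 : e τ = e τ' * Real.exp (A τ - A τ') := by
          rw [he]; simp only []; rw [← Real.exp_add]; congr 1; ring
        have h3 : 0 < e τ' := Real.exp_pos _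
        nlinarith
      have s5 := mul_le_mul_of_nonneg_left s4 (hY τ ⟨hτ, hττ'.trans hτ'⟩).1
      have s6 := mul_le_mul_of_nonneg_right h (Real.exp_nonneg (A τ'))
      change y τ' * e τ' ≤ (y τ + ∫ σ in τ..τ', (ε - a σ * y σ)) * e τ' at s6
      linarith
    · refine Eventually.of_forall fun σ hσ => ?_
      have m0 : τ ∈ I := ⟨hτ, hττ'.trans hτ'⟩
      have m1 : σ ∈ I := ⟨hτ.trans hσ.1, hσ.2.trans_lt hτ'⟩
      have m2 : τ' ∈ I := ⟨hτ.trans hττ', hτ'⟩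
      simp only [indicator_of_mem m0, indicator_of_mem m1, indicator_of_mem m2]
      refine (enorm_add_le _ _).trans ?_
      have b1 : ‖a σ * (y τ - y σ) * e τ'‖ₑ ≤ ‖E * a σ‖ₑ * ‖y τ - y σ‖ₑ := by
        rw [← enorm_mul]
        refine enorm_le_iff_norm_le.2 ?_
        have h1 := hE' τ' (Ioo_subset_Icc_self m2)
        have h2 : |e τ'| = e τ' := abs_of_pos (Real.exp_pos _)
        simp only [norm_mul, Real.norm_eq_abs, abs_of_nonneg hE0, h2]
        calc |a σ| * |y τ - y σ| * e τ' ≤ |a σ| * |y τ - y σ| * E := by gcongr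
          _ = _ := by ring
      rw [enorm_sub_rev (ε * e τ')]
      calc _ ≤ ‖E * a σ‖ₑ * ‖y τ - y σ‖ₑ + ‖ε * e σ - ε * e τ'‖ₑ := by gcongr
        _ ≤ _ := add_le_add le_self_add le_add_self)
  refine main.mono fun s t hs hst ht h => ?_
  have s2 : (∫ σ in c..t, e σ) - ∫ σ in c..s, e σ = ∫ σ in s..t, e σ :=
    intervalIntegral.integral_interval_sub_left (heI' le_rfl (hs.trans hst).le ht.le)
      (heI' le_rfl hs.le (hst.trans ht).le)
  change y t * e t ≤ y s * e s + ε * ∫ τ in s..t, e τ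
  rw [← s2]
  linarith

/-! ### Evolution equations with an antisymmetric trilinear form -/

section Evolution

variable {V H : Type*} [NormedAddCommGroup V] [InnerProductSpace ℝ V]
  [NormedAddCommGroup H] [InnerProductSpace ℝ H]

/-- A trilinear form `b` on `V`, antisymmetric in its last two arguments, with a bound by the norms
of `H` and a quantity `M` of the middle argument. -/
structure AdvectionForm (j : V →L[ℝ] H) (b : V →L[ℝ] V →L[ℝ] V →L[ℝ] ℝ) (M : V → ℝ≥0∞) :
    Prop where
  antisymm : ∀ u v w, b u v w = -b u w v
  bound : ∀ u v w, M v ≠ ⊤ → |b u v w| ≤ (M v).toReal * ‖j u‖ * ‖j w‖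
  lowerSemicontinuous : LowerSemicontinuous M

/-- A weakly continuous solution `u` of `u' + b(u, u, ·) = a`, with `V`-valued version `U`. -/
structure Evolution (j : V →L[ℝ] H) (b : V →L[ℝ] V →L[ℝ] V →L[ℝ] ℝ) (u : ℝ → H) (U : ℝ → V)
    (a u' : ℝ → StrongDual ℝ V) : Prop where
  weaklyContinuous : ∀ h : H, ContinuousOn (fun t => inner ℝ (u t) h) (Ici 0)
  memLp : ∀ T, 0 < T → MemLp U 2 (volume.restrict (Ioc 0 T))
  memLp_force : ∀ T, 0 < T → MemLp a 2 (volume.restrict (Ioc 0 T))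
  ae_eq : ∀ᵐ t : ℝ, 0 < t → j (U t) = u t
  locallyIntegrableOn : LocallyIntegrableOn u' (Ioi 0)
  increment : ∀ s t, 0 < s → s ≤ t → ∀ φ,
    inner ℝ (u t) (j φ) - inner ℝ (u s) (j φ) = ∫ τ in s..t, u' τ φ
  equation : ∀ᵐ t : ℝ, 0 < t → ∀ φ, u' t φ = a t φ - b (U t) (U t) φ

variable {j : V →L[ℝ] H} {b : V →L[ℝ] V →L[ℝ] V →L[ℝ] ℝ} {M : V → ℝ≥0∞}

/-- The uniform boundedness principle, applied to the functionals `⟨u(t), ·⟩` for `t` in a compact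
interval. -/
theorem exists_norm_le_of_weaklyContinuous [CompleteSpace H] {u : ℝ → H}
    (hu : ∀ h : H, ContinuousOn (fun t => inner ℝ (u t) h) (Ici 0)) (d : ℝ) :
    ∃ C, 0 ≤ C ∧ ∀ t ∈ Icc 0 d, ‖u t‖ ≤ C := by
  obtain ⟨C, hC⟩ := banach_steinhaus (g := fun t : Icc (0 : ℝ) d => innerSL ℝ (u t)) (fun h => by
    obtain ⟨C, hC⟩ := isCompact_Icc.exists_bound_of_continuousOn
      ((hu h).mono (show Icc 0 d ⊆ Ici 0 from fun _ h => h.1))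
    exact ⟨C, fun t => by simpa using hC t t.2⟩)
  refine ⟨max C 0, le_max_right _ _, fun t ht => ?_⟩
  simpa using (hC ⟨t, ht⟩).trans (le_max_left _ 0)

theorem aestronglyMeasurable_of_ae_eq {u : ℝ → H} {U : ℝ → V} {I : Set ℝ} (hI : MeasurableSet I)
    (hI0 : I ⊆ Ioi 0) (h : ∀ᵐ t : ℝ, 0 < t → j (U t) = u t)
    (hU : AEStronglyMeasurable U (volume.restrict I)) :
    AEStronglyMeasurable u (volume.restrict I) := by
  refine (j.continuous.comp_aestronglyMeasurable hU).congr ?_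
  refine (ae_restrict_iff' hI).2 ?_
  filter_upwards [h] with t ht h'
  exact ht (hI0 h')

theorem AdvectionForm.aemeasurable (hb : AdvectionForm j b M) {U : ℝ → V} {μ : Measure ℝ}
    (hU : AEStronglyMeasurable U μ) : AEMeasurable (fun t => M (U t)) μ := by
  borelize V
  exact hb.lowerSemicontinuous.measurable.comp_aemeasurable hU.aemeasurable

theorem integrable_apply_of_memLp_two {μ : Measure ℝ} {a : ℝ → StrongDual ℝ V} {U : ℝ → V}
    (ha : MemLp a 2 μ) (hU : MemLp U 2 μ) : Integrable (fun t => a t (U t)) μ :=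
  memLp_one_iff_integrable.1
    ((ContinuousLinearMap.id ℝ (StrongDual ℝ V)).memLp_of_bilin 1 ha hU)

theorem aestronglyMeasurable_trilinear {μ : Measure ℝ} {U U₁ U₂ : ℝ → V}
    (hU : AEStronglyMeasurable U μ) (hU₁ : AEStronglyMeasurable U₁ μ)
    (hU₂ : AEStronglyMeasurable U₂ μ) :
    AEStronglyMeasurable (fun t => b (U t) (U₁ t) (U₂ t)) μ := by
  have h : Continuous fun p : V × V × V => b p.1 p.2.1 p.2.2 := by fun_prop
  exact h.comp_aestronglyMeasurable (hU.prodMk (hU₁.prodMk hU₂))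

namespace Evolution

variable {u v : ℝ → H} {U W : ℝ → V} {a a₂ u' v' : ℝ → StrongDual ℝ V}

theorem memLp_Ioo (hu : Evolution j b u U a u') {c : ℝ} (hc : 0 < c) (d : ℝ) :
    MemLp U 2 (volume.restrict (Ioo c d)) :=
  (hu.memLp (max d 1) (by simp)).mono_measure (Measure.restrict_mono
    (show Ioo c d ⊆ Ioc 0 (max d 1) from
      fun _ h => ⟨hc.trans h.1, h.2.le.trans (le_max_left _ _)⟩) le_rfl)

theorem memLp_force_Ioo (hu : Evolution j b u U a u') {c : ℝ} (hc : 0 < c) (d : ℝ) :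
    MemLp a 2 (volume.restrict (Ioo c d)) :=
  (hu.memLp_force (max d 1) (by simp)).mono_measure (Measure.restrict_mono
    (show Ioo c d ⊆ Ioc 0 (max d 1) from
      fun _ h => ⟨hc.trans h.1, h.2.le.trans (le_max_left _ _)⟩) le_rfl)

/-- Square integrability in `V` does not suffice for a cubic term. Here `X` and `Y` enter only
through their `H`-norms, which are bounded, so integrability of `M(U)` is enough. -/
theorem integrableOn_advection [CompleteSpace H] (hb : AdvectionForm j b M)
    (hu : Evolution j b u U a u') {c d : ℝ} (hc : 0 < c) (hM : ∫⁻ τ in Ioo c d, M (U τ) ≠ ⊤)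
    {x y : ℝ → H} {X Y : ℝ → V} {ax ay x' y' : ℝ → StrongDual ℝ V}
    (hx : Evolution j b x X ax x') (hy : Evolution j b y Y ay y') :
    IntegrableOn (fun τ => b (X τ) (U τ) (Y τ)) (Ioo c d) := by
  obtain ⟨C, hC0, hC⟩ := exists_norm_le_of_weaklyContinuous hx.weaklyContinuous d
  obtain ⟨D, hD0, hD⟩ := exists_norm_le_of_weaklyContinuous hy.weaklyContinuous d
  have hMm := hb.aemeasurable (hu.memLp_Ioo hc d).1
  have hm := integrable_toReal_of_lintegral_ne_top hMm hM
  refine (hm.mul_const (C * D)).mono' (aestronglyMeasurable_trilinear (hx.memLp_Ioo hc d).1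
    (hu.memLp_Ioo hc d).1 (hy.memLp_Ioo hc d).1) ?_
  filter_upwards [ae_lt_top' hMm hM, ae_restrict_of_ae hx.ae_eq, ae_restrict_of_ae hy.ae_eq,
    ae_restrict_mem measurableSet_Ioo] with τ h1 h2 h3 h4
  have h5 : τ ∈ Icc 0 d := ⟨(hc.trans h4.1).le, h4.2.le⟩
  have := hb.bound (X τ) (U τ) (Y τ) h1.ne
  rw [h2 (hc.trans h4.1), h3 (hc.trans h4.1)] at this
  calc ‖b (X τ) (U τ) (Y τ)‖ ≤ (M (U τ)).toReal * ‖x τ‖ * ‖y τ‖ := this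
    _ ≤ (M (U τ)).toReal * C * D := by gcongr; exacts [hC τ h5, hD τ h5]
    _ = _ := by ring

/-- The dangerous term `b(W,W,U)` equals `-b(W,U,W)`, so that the gradient bound is needed for `U`
only. -/
theorem integrableOn_deriv_apply_add [CompleteSpace H] (hb : AdvectionForm j b M)
    (hu : Evolution j b u U a u') (hv : Evolution j b v W a₂ v') {c d : ℝ} (hc : 0 < c)
    (hM : ∫⁻ τ in Ioo c d, M (U τ) ≠ ⊤) :
    IntegrableOn (fun τ => u' τ (W τ) + v' τ (U τ)) (Ioo c d) := by
  have h1 := integrable_apply_of_memLp_two (hu.memLp_force_Ioo hc d) (hv.memLp_Ioo hc d)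
  have h2 := integrable_apply_of_memLp_two (hv.memLp_force_Ioo hc d) (hu.memLp_Ioo hc d)
  have h3 := integrableOn_advection hb hu hc hM hu hv
  have h4 := integrableOn_advection hb hu hc hM hv hv
  refine ((h1.sub h3).add (h2.add h4)).congr ?_
  filter_upwards [ae_restrict_of_ae hu.equation, ae_restrict_of_ae hv.equation,
    ae_restrict_mem measurableSet_Ioo] with τ e1 e2 hτ
  simp only [Pi.add_apply, Pi.sub_apply]
  rw [e1 (hc.trans hτ.1), e2 (hc.trans hτ.1), hb.antisymm (W τ) (U τ)]
  ring

/-- The product rule for `⟨u, v⟩` when the advection by `u` is integrable in time. -/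
theorem inner_sub_inner [CompleteSpace H] (hb : AdvectionForm j b M)
    (hu : Evolution j b u U a u') (hv : Evolution j b v W a₂ v') {c d : ℝ} (hc : 0 < c)
    (hM : ∫⁻ τ in Ioo c d, M (U τ) ≠ ⊤) :
    AEPairs c d fun s t => inner ℝ (u t) (v t) - inner ℝ (u s) (v s) =
      ∫ τ in s..t, (u' τ (W τ) + v' τ (U τ)) := by
  rcases le_or_gt d c with hcd | hcd
  · exact ⟨fun _ => True, by simp, fun s _ t _ h1 h2 h3 => by linarith⟩
  set I := Ioo c d with hI
  have hIm : MeasurableSet I := measurableSet_Ioo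
  have hI0 : I ⊆ Ioi 0 := fun τ hτ => hc.trans hτ.1
  obtain ⟨C₁, hC₁0, hC₁⟩ := exists_norm_le_of_weaklyContinuous hu.weaklyContinuous d
  obtain ⟨C₂, hC₂0, hC₂⟩ := exists_norm_le_of_weaklyContinuous hv.weaklyContinuous d
  have hIcc : I ⊆ Icc 0 d := fun τ hτ => ⟨(hc.trans hτ.1).le, hτ.2.le⟩
  have hMm := hb.aemeasurable (hu.memLp_Ioo hc d).1
  set m : ℝ → ℝ := fun τ => (M (U τ)).toReal with hm_def
  have hm : IntegrableOn m I := integrable_toReal_of_lintegral_ne_top hMm hM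
  have hum := aestronglyMeasurable_of_ae_eq hIm hI0 hu.ae_eq (hu.memLp_Ioo hc d).1
  have hvm := aestronglyMeasurable_of_ae_eq hIm hI0 hv.ae_eq (hv.memLp_Ioo hc d).1
  set Q : ℝ → ℝ := fun τ => u' τ (W τ) + v' τ (U τ) with hQ_def
  have hQ : IntegrableOn Q I := integrableOn_deriv_apply_add hb hu hv hc hM
  set q : ℝ → ℝ := fun τ => b (W τ) (U τ) (W τ) with hq_def
  have hq : IntegrableOn q I := integrableOn_advection hb hu hc hM hv hv
  have hQI {a' b' : ℝ} (h1 : c ≤ a') (h2 : a' ≤ b') (h3 : b' ≤ d) :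
      IntervalIntegrable Q volume a' b' := intervalIntegrable_of_integrableOn_Ioo hQ h1 h2 h3
  have hP : IntegrableOn (fun τ => (inner ℝ (u τ) (v τ) : ℝ)) I := by
    have : IsFiniteMeasure (volume.restrict I) := ⟨by simp [hI]⟩
    refine Integrable.of_bound (hum.inner hvm) (C₁ * C₂) ?_
    refine (ae_restrict_iff' hIm).2 (Eventually.of_forall fun τ hτ => ?_)
    refine (norm_inner_le_norm _ _).trans ?_
    gcongr
    exacts [hC₁ τ (hIcc hτ), hC₂ τ (hIcc hτ)]
  have hΦ : IntegrableOn (fun τ => ∫ x in c..τ, Q x) I := by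
    have := intervalIntegral.continuousOn_primitive_interval (μ := volume) (f := Q) (a := c) (b := d)
      (by rw [uIcc_of_le hcd.le, integrableOn_Icc_iff_integrableOn_Ioo]; exact hQ)
    rw [uIcc_of_le hcd.le] at this
    exact (this.integrableOn_Icc (μ := volume)).mono_set Ioo_subset_Icc_self
  have hL2 {E : Type _} [NormedAddCommGroup E] {f : ℝ → E}
      (hf : MemLp f 2 (volume.restrict I)) : MemLp (I.indicator f) 2 volume :=
    (memLp_indicator_iff_restrict hIm).2 hf
  have hΘ1 := (DiagSmall.of_memLp_two (hL2 (hu.memLp_force_Ioo hc d))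
    (hL2 (hv.memLp_Ioo hc d))).swap
  have hΘ2 := (DiagSmall.of_bounded (((hm.integrable_indicator hIm).const_mul C₁))
    ((aestronglyMeasurable_indicator_iff hIm).2 hvm)
    (norm_indicator_le_of_forall hC₂0 fun τ hτ => hC₂ τ (hIcc hτ))).swap
  have hΘ3 := (DiagSmall.of_memLp_two (hL2 (hv.memLp_force_Ioo hc d))
    (hL2 (hu.memLp_Ioo hc d))).swap
  have hΘ4 := DiagSmall.of_bounded (((hm.integrable_indicator hIm).const_mul (2 * C₂)))
    ((aestronglyMeasurable_indicator_iff hIm).2 hvm)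
    (norm_indicator_le_of_forall hC₂0 fun τ hτ => hC₂ τ (hIcc hτ))
  have hΘ5 := DiagSmall.of_integrable (hq.integrable_indicator hIm)
  -- The first two terms bound the error of testing `u'` with `W τ'` instead of `W σ`, the last
  -- three that of testing `v'` with `U τ` instead of `U σ`.
  set Θ : ℝ → ℝ → ℝ≥0∞ := fun σ τ =>
    ‖I.indicator a σ‖ₑ * ‖I.indicator W τ - I.indicator W σ‖ₑ +
    ‖C₁ * I.indicator m σ‖ₑ * ‖I.indicator v τ - I.indicator v σ‖ₑ +
    ‖I.indicator a₂ σ‖ₑ * ‖I.indicator U τ - I.indicator U σ‖ₑ +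
    ‖2 * C₂ * I.indicator m τ‖ₑ * ‖I.indicator v σ - I.indicator v τ‖ₑ +
    ‖I.indicator q σ - I.indicator q τ‖ₑ with hΘ_def
  have hΘ : DiagSmall Θ := (((hΘ1.add hΘ2).add hΘ3).add hΘ4).add hΘ5
  have good : ∀ᵐ τ, τ ∈ I → j (U τ) = u τ ∧ j (W τ) = v τ ∧ M (U τ) ≠ ⊤ ∧
      (∀ φ, u' τ φ = a τ φ - b (U τ) (U τ) φ) ∧ (∀ φ, v' τ φ = a₂ τ φ - b (W τ) (W τ) φ) := by
    have hfin := (ae_restrict_iff' hIm).1 (ae_lt_top' hMm hM)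
    filter_upwards [hu.ae_eq, hv.ae_eq, hfin, hu.equation, hv.equation] with τ h1 h2 h3 h4 h5 hτ
    exact ⟨h1 (hI0 hτ), h2 (hI0 hτ), (h3 hτ).ne, h4 (hI0 hτ), h5 (hI0 hτ)⟩
  have loc {w' : ℝ → StrongDual ℝ V} (hw : LocallyIntegrableOn w' (Ioi 0)) {τ τ' : ℝ}
      (hτ : τ ∈ I) (hττ' : τ ≤ τ') (φ : V) :
      IntervalIntegrable (fun σ => w' σ φ) volume τ τ' := by
    rw [intervalIntegrable_iff_integrableOn_Icc_of_le hττ']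
    have := hw.integrableOn_compact_subset
      (show Icc τ τ' ⊆ Ioi 0 from fun x hx => (hI0 hτ).trans_le hx.1) isCompact_Icc
    exact this.apply_continuousLinearMap φ
  set Z : ℝ → ℝ := fun τ => inner ℝ (u τ) (v τ) - ∫ x in c..τ, Q x with hZ_def
  have hZ : IntegrableOn Z I := hP.sub hΦ
  have key : AEPairs c d fun τ τ' => ENNReal.ofReal |Z τ' - Z τ| ≤
      ∫⁻ σ in Ioc τ τ', Θ σ τ + Θ σ τ' := by
    refine ⟨_, good, fun τ gτ τ' gτ' hτ hττ' hτ' => ?_⟩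
    have m0 : τ ∈ I := ⟨hτ, hττ'.trans hτ'⟩
    have m2 : τ' ∈ I := ⟨hτ.trans hττ', hτ'⟩
    obtain ⟨eU, eW, eM, eu, ev⟩ := gτ m0
    obtain ⟨eU', eW', -, -, -⟩ := gτ' m2
    -- Discrete product rule: the increment of `⟨u, v⟩` is the increment of `u` against `v(τ')` plus
    -- that of `v` against `u(τ)`.
    refine ofReal_le_setLIntegral_of_le_abs_integral (G := fun σ =>
      (u' σ (W τ') + v' σ (U τ)) - Q σ) hττ'.le (le_of_eq ?_) ?_
    · congr 1
      rw [intervalIntegral.integral_sub ((loc hu.locallyIntegrableOn m0 hττ'.le _).add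
        (loc hv.locallyIntegrableOn m0 hττ'.le _)) (hQI hτ.le hττ'.le hτ'.le),
        intervalIntegral.integral_add (loc hu.locallyIntegrableOn m0 hττ'.le _)
        (loc hv.locallyIntegrableOn m0 hττ'.le _), ← hu.increment τ τ' (hI0 m0) hττ'.le,
        ← hv.increment τ τ' (hI0 m0) hττ'.le, eW', eU]
      have s2 : (∫ σ in c..τ', Q σ) - ∫ σ in c..τ, Q σ = ∫ σ in τ..τ', Q σ :=
        intervalIntegral.integral_interval_sub_left (hQI le_rfl m2.1.le hτ'.le)
          (hQI le_rfl hτ.le m0.2.le)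
      rw [← s2, real_inner_comm (u τ) (v τ'), real_inner_comm (u τ) (v τ)]
      simp only [hZ_def]
      ring
    · filter_upwards [good] with σ gσ hσ
      have m1 : σ ∈ I := ⟨hτ.trans hσ.1, hσ.2.trans_lt hτ'⟩
      obtain ⟨fU, fW, fM, fu, fv⟩ := gσ m1
      -- `U τ - U σ` need not be small in the sense of `M`. Antisymmetry turns its advection term
      -- into `b(W σ, U τ, W σ) - q σ`; inserting `q τ = b(W τ, U τ, W τ)` leaves differences of
      -- `W`, measured in `H`, and a translation difference of the integrable function `q`.
      have split : (u' σ (W τ') + v' σ (U τ)) - Q σ =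
          a σ (W τ' - W σ) + -b (U σ) (U σ) (W τ' - W σ) + a₂ σ (U τ - U σ) +
          (b (W σ - W τ) (U τ) (W σ) + b (W τ) (U τ) (W σ - W τ)) + -(q σ - q τ) := by
        simp only [hQ_def, hq_def, fu, fv, map_sub, sub_apply]
        rw [hb.antisymm (W σ) (W σ) (U τ), hb.antisymm (W σ) (W σ) (U σ)]
        ring
      have b1 : ‖a σ (W τ' - W σ)‖ₑ ≤ ‖a σ‖ₑ * ‖W τ' - W σ‖ₑ :=
        enorm_le_mul_enorm ((a σ).le_opNorm _)
      have b2 : ‖-b (U σ) (U σ) (W τ' - W σ)‖ₑ ≤ ‖C₁ * m σ‖ₑ * ‖v τ' - v σ‖ₑ := by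
        refine enorm_le_mul_enorm ?_
        have := hb.bound (U σ) (U σ) (W τ' - W σ) fM
        rw [map_sub j, fU, fW, eW'] at this
        rw [norm_neg, norm_mul, Real.norm_of_nonneg hC₁0,
          Real.norm_of_nonneg (ENNReal.toReal_nonneg : 0 ≤ m σ)]
        calc _ ≤ m σ * ‖u σ‖ * ‖v τ' - v σ‖ := this
          _ ≤ m σ * C₁ * ‖v τ' - v σ‖ := by gcongr; exact hC₁ σ (hIcc m1)
          _ = _ := by ring
      have b3 : ‖a₂ σ (U τ - U σ)‖ₑ ≤ ‖a₂ σ‖ₑ * ‖U τ - U σ‖ₑ :=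
        enorm_le_mul_enorm ((a₂ σ).le_opNorm _)
      have b4 : ‖b (W σ - W τ) (U τ) (W σ) + b (W τ) (U τ) (W σ - W τ)‖ₑ ≤
          ‖2 * C₂ * m τ‖ₑ * ‖v σ - v τ‖ₑ := by
        refine enorm_le_mul_enorm ?_
        have h1 := hb.bound (W σ - W τ) (U τ) (W σ) eM
        have h2 := hb.bound (W τ) (U τ) (W σ - W τ) eM
        rw [map_sub j, fW, eW] at h1 h2
        rw [norm_mul, norm_mul, Real.norm_of_nonneg hC₂0, Real.norm_two,
          Real.norm_of_nonneg (ENNReal.toReal_nonneg : 0 ≤ m τ)]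
        refine (norm_add_le _ _).trans ?_
        calc _ ≤ m τ * ‖v σ - v τ‖ * ‖v σ‖ + m τ * ‖v τ‖ * ‖v σ - v τ‖ := add_le_add h1 h2
          _ ≤ m τ * ‖v σ - v τ‖ * C₂ + m τ * C₂ * ‖v σ - v τ‖ := by
            gcongr
            exacts [hC₂ σ (hIcc m1), hC₂ τ (hIcc m0)]
          _ = _ := by ring
      rw [split]
      simp only [hΘ_def, indicator_of_mem m0, indicator_of_mem m1, indicator_of_mem m2]
      calc _ ≤ ‖a σ‖ₑ * ‖W τ' - W σ‖ₑ + ‖C₁ * m σ‖ₑ * ‖v τ' - v σ‖ₑ + ‖a₂ σ‖ₑ * ‖U τ - U σ‖ₑ +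
            ‖2 * C₂ * m τ‖ₑ * ‖v σ - v τ‖ₑ + ‖q σ - q τ‖ₑ := by
            refine (enorm_add_le _ _).trans (add_le_add ?_ (enorm_neg _).le)
            refine (enorm_add_le _ _).trans (add_le_add ?_ b4)
            refine (enorm_add_le _ _).trans (add_le_add ?_ b3)
            exact (enorm_add_le _ _).trans (add_le_add b1 b2)
        _ = (‖a₂ σ‖ₑ * ‖U τ - U σ‖ₑ + ‖2 * C₂ * m τ‖ₑ * ‖v σ - v τ‖ₑ + ‖q σ - q τ‖ₑ) +
            (‖a σ‖ₑ * ‖W τ' - W σ‖ₑ + ‖C₁ * m σ‖ₑ * ‖v τ' - v σ‖ₑ) := by ring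
        _ ≤ _ := by
            refine add_le_add (add_le_add (add_le_add le_add_self le_rfl) le_rfl) ?_
            rw [add_assoc, add_assoc]
            exact le_self_add
  -- The increments are bounded in absolute value, so both `Z` and `-Z` are nonincreasing and `Z` is
  -- almost everywhere constant.
  have k1 := AEPairs.antitone_of_diagSmall hΘ hZ (key.mono fun τ τ' _ _ _ h =>
    (ENNReal.ofReal_le_ofReal (le_abs_self _)).trans h)
  have k2 := AEPairs.antitone_of_diagSmall hΘ hZ.neg (key.mono fun τ τ' _ _ _ h => by
    refine (ENNReal.ofReal_le_ofReal ?_).trans h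
    simpa only [Pi.neg_apply, neg_sub_neg, abs_sub_comm] using le_abs_self (Z τ - Z τ'))
  refine (k1.and k2).mono fun s t hs hst ht h => ?_
  have s2 : (∫ σ in c..t, Q σ) - ∫ σ in c..s, Q σ = ∫ σ in s..t, Q σ :=
    intervalIntegral.integral_interval_sub_left (hQI le_rfl (hs.trans hst).le ht.le)
      (hQI le_rfl hs.le (hst.trans ht).le)
  rw [← s2]
  have h3 : Z t = Z s := le_antisymm h.1 (neg_le_neg_iff.1 h.2)
  simp only [hZ_def] at h3
  linarith

end Evolution
end Evolution

/-! ### Continuous functions with a locally integrable weak derivative -/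

theorem deriv_smoothTransition_eq_zero {x : ℝ} (hx : x ∉ Icc (0 : ℝ) 1) :
    deriv Real.smoothTransition x = 0 := by
  have : ∃ C : ℝ, Real.smoothTransition =ᶠ[𝓝 x] fun _ => C := by
    rcases lt_or_ge x 0 with h | h
    · exact ⟨0, by filter_upwards [eventually_lt_nhds h] with y hy using
        Real.smoothTransition.zero_of_nonpos hy.le⟩
    · have h1 : 1 < x := by
        by_contra h1
        exact hx ⟨h, not_lt.1 h1⟩
      exact ⟨1, by filter_upwards [eventually_gt_nhds h1] with y hy using
        Real.smoothTransition.one_of_one_le hy.le⟩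
  obtain ⟨C, hC⟩ := this
  rw [hC.deriv_eq, deriv_const]

theorem continuous_deriv_smoothTransition : Continuous (deriv Real.smoothTransition) :=
  (Real.smoothTransition.contDiff (n := 1)).continuous_deriv le_rfl

/-- A smooth step from `0` to `1` on `[s, s + 1 / (n + 1)]`. -/
noncomputable def smoothStep (s : ℝ) (n : ℕ) (τ : ℝ) : ℝ := Real.smoothTransition ((n + 1) * (τ - s))

theorem contDiff_smoothStep (s : ℝ) (n : ℕ) : ContDiff ℝ ∞ (smoothStep s n) :=
  Real.smoothTransition.contDiff.comp (by fun_prop)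

theorem deriv_smoothStep (s : ℝ) (n : ℕ) (τ : ℝ) :
    deriv (smoothStep s n) τ = (n + 1) * deriv Real.smoothTransition ((n + 1) * (τ - s)) := by
  have h1 : HasDerivAt (fun τ : ℝ => ((n : ℝ) + 1) * (τ - s)) (n + 1) τ := by
    simpa using ((hasDerivAt_id τ).sub_const s).const_mul ((n : ℝ) + 1)
  have h2 : HasDerivAt Real.smoothTransition (deriv Real.smoothTransition ((n + 1) * (τ - s)))
      ((n + 1) * (τ - s)) :=
    ((Real.smoothTransition.contDiff (n := 1)).differentiable (by simp) _).hasDerivAt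
  rw [mul_comm]
  exact (h2.comp τ h1).deriv

theorem smoothStep_eq_zero {s : ℝ} {n : ℕ} {τ : ℝ} (h : τ ≤ s) : smoothStep s n τ = 0 :=
  Real.smoothTransition.zero_of_nonpos
    (mul_nonpos_of_nonneg_of_nonpos (by positivity) (by linarith))

theorem smoothStep_eq_one {s : ℝ} {n : ℕ} {τ : ℝ} (h : 1 ≤ ((n : ℝ) + 1) * (τ - s)) :
    smoothStep s n τ = 1 :=
  Real.smoothTransition.one_of_one_le h

theorem deriv_smoothStep_eq_zero {s : ℝ} {n : ℕ} {τ : ℝ}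
    (h : τ ∉ Icc s (s + 1 / ((n : ℝ) + 1))) : deriv (smoothStep s n) τ = 0 := by
  rw [deriv_smoothStep, deriv_smoothTransition_eq_zero, mul_zero]
  refine fun h' => h ⟨?_, ?_⟩
  · by_contra h1
    have : ((n : ℝ) + 1) * (τ - s) < 0 := mul_neg_of_pos_of_neg (by positivity) (by linarith)
    linarith [h'.1]
  · have := (le_div_iff₀' (by positivity : (0 : ℝ) < (n : ℝ) + 1)).2 h'.2
    linarith

theorem integrableOn_deriv_smoothStep_mul {p : ℝ → ℝ} (hp : ContinuousOn p (Ioi 0)) {s : ℝ}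
    (hs : 0 < s) (n : ℕ) : IntegrableOn (fun τ => deriv (smoothStep s n) τ * p τ) (Ioi 0) := by
  have h1 : IntegrableOn (fun τ => deriv (smoothStep s n) τ * p τ)
      (Icc s (s + 1 / ((n : ℝ) + 1))) := by
    refine ContinuousOn.integrableOn_Icc (ContinuousOn.mul ?_ (hp.mono fun x hx => hs.trans_le hx.1))
    exact ((contDiff_smoothStep s n).continuous_deriv (by simp)).continuousOn
  refine IntegrableOn.of_forall_sdiff_eq_zero h1 measurableSet_Ioi fun x hx => ?_
  simp only [deriv_smoothStep_eq_zero hx.2, zero_mul]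

/-- The derivatives of the steps form an approximate identity concentrating at `s` from the right;
rescaling to `[0, 1]` reduces this to dominated convergence. -/
theorem tendsto_integral_deriv_smoothStep_mul {p : ℝ → ℝ} (hp : ContinuousOn p (Ioi 0)) {s : ℝ}
    (hs : 0 < s) :
    Tendsto (fun n : ℕ => ∫ τ in Ioi (0 : ℝ), deriv (smoothStep s n) τ * p τ) atTop (𝓝 (p s)) := by
  have e1 : ∀ n : ℕ, ∫ τ in Ioi (0 : ℝ), deriv (smoothStep s n) τ * p τ =
      ∫ x in (0 : ℝ)..1, deriv Real.smoothTransition x * p (s + x / ((n : ℝ) + 1)) := by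
    intro n
    have hn : (0 : ℝ) < (n : ℝ) + 1 := by positivity
    have h2 : ∫ τ in Ioi (0 : ℝ), deriv (smoothStep s n) τ * p τ =
        ∫ τ in Icc s (s + 1 / ((n : ℝ) + 1)), deriv (smoothStep s n) τ * p τ := by
      refine setIntegral_eq_of_subset_of_forall_sdiff_eq_zero measurableSet_Ioi
        (fun x hx => hs.trans_le hx.1) fun x hx => ?_
      rw [deriv_smoothStep_eq_zero hx.2, zero_mul]
    rw [h2, integral_Icc_eq_integral_Ioc, ← intervalIntegral.integral_of_le (by simp; positivity)]
    have h3 := intervalIntegral.integral_comp_div_add (a := 0) (b := 1)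
      (fun τ => deriv (smoothStep s n) τ * p τ) hn.ne' s
    rw [zero_div, zero_add, add_comm (1 / _) s] at h3
    rw [← inv_smul_smul₀ hn.ne' (∫ τ in s..s + 1 / ((n : ℝ) + 1), _), ← h3, smul_eq_mul,
      ← intervalIntegral.integral_const_mul]
    refine intervalIntegral.integral_congr fun x _ => ?_
    simp only [deriv_smoothStep]
    rw [add_sub_cancel_right, mul_div_cancel₀ _ hn.ne', add_comm s]
    field_simp
  simp_rw [e1]
  obtain ⟨C, hC⟩ := isCompact_Icc.exists_bound_of_continuousOn
    (hp.mono (show Icc s (s + 1) ⊆ Ioi 0 from fun x hx => hs.trans_le hx.1))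
  have hlim : (∫ x in (0 : ℝ)..1, deriv Real.smoothTransition x * p s) = p s := by
    rw [intervalIntegral.integral_mul_const, intervalIntegral.integral_deriv_eq_sub]
    · simp
    · exact fun x _ => (Real.smoothTransition.contDiff (n := 1)).differentiable (by simp) x
    · exact continuous_deriv_smoothTransition.intervalIntegrable _ _
  rw [← hlim]
  have mem : ∀ (n : ℕ) (x : ℝ), x ∈ Ioc (0 : ℝ) 1 → s + x / ((n : ℝ) + 1) ∈ Icc s (s + 1) := by
    intro n x hx
    have hn : (1 : ℝ) ≤ (n : ℝ) + 1 := by simp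
    have h1 : 0 ≤ x / ((n : ℝ) + 1) := div_nonneg hx.1.le (by linarith)
    have h2 : x / ((n : ℝ) + 1) ≤ 1 := div_le_one_of_le₀ (hx.2.trans hn) (by linarith)
    exact ⟨by linarith, by linarith⟩
  refine intervalIntegral.tendsto_integral_filter_of_dominated_convergence
    (fun x => ‖deriv Real.smoothTransition x‖ * C) ?_ ?_ ?_ ?_
  · refine Eventually.of_forall fun n => ?_
    rw [uIoc_of_le zero_le_one]
    refine (ContinuousOn.mul continuous_deriv_smoothTransition.continuousOn
      (hp.comp (by fun_prop) fun x hx => ?_)).aestronglyMeasurable measurableSet_Ioc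
    exact hs.trans_le (mem n x hx).1
  · refine Eventually.of_forall fun n => Eventually.of_forall fun x hx => ?_
    rw [uIoc_of_le zero_le_one] at hx
    rw [norm_mul]
    gcongr
    exact hC _ (mem n x hx)
  · exact (continuous_deriv_smoothTransition.norm.mul continuous_const).intervalIntegrable _ _
  · refine Eventually.of_forall fun x _ => Tendsto.const_mul _ ?_
    refine ((hp.continuousAt (Ioi_mem_nhds hs)).tendsto).comp ?_
    have : Tendsto (fun n : ℕ => s + x * (1 / ((n : ℝ) + 1))) atTop (𝓝 (s + x * 0)) :=
      (tendsto_one_div_add_atTop_nhds_zero_nat.const_mul x).const_add s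
    simpa [div_eq_mul_inv] using this

/-- Test with the difference of the steps at `s` and at `t`, a smooth approximation of the indicator
of `(s, t]`. -/
theorem sub_eq_integral_of_weak_deriv {p q : ℝ → ℝ} (hp : ContinuousOn p (Ioi 0))
    (hq : LocallyIntegrableOn q (Ioi 0))
    (h : ∀ η : ℝ → ℝ, ContDiff ℝ ∞ η → HasCompactSupport η → tsupport η ⊆ Ioi 0 →
      ∫ t in Ioi (0 : ℝ), deriv η t * p t = -∫ t in Ioi (0 : ℝ), η t * q t)
    {s t : ℝ} (hs : 0 < s) (hst : s ≤ t) : p t - p s = ∫ τ in s..t, q τ := by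
  set η : ℕ → ℝ → ℝ := fun n τ => smoothStep s n τ - smoothStep t n τ with hη
  have hzero : ∀ n, ∀ τ, τ ∉ Icc s (t + 1) → η n τ = 0 := by
    intro n τ hτ
    rcases le_or_gt τ s with h1 | h1
    · simp only [hη, smoothStep_eq_zero h1, smoothStep_eq_zero (h1.trans hst), sub_zero]
    · have h2 : t + 1 < τ := by
        by_contra h2
        exact hτ ⟨h1.le, not_lt.1 h2⟩
      have hn : (1 : ℝ) ≤ (n : ℝ) + 1 := by simp
      simp only [hη]
      rw [smoothStep_eq_one, smoothStep_eq_one, sub_self] <;> nlinarith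
  have hcs : ∀ n, tsupport (η n) ⊆ Icc s (t + 1) := fun n =>
    closure_minimal (fun τ hτ => by_contra fun h' => hτ (hzero n τ h')) isClosed_Icc
  have hI : IntegrableOn q (Icc s (t + 1)) :=
    hq.integrableOn_compact_subset (fun x hx => hs.trans_le hx.1) isCompact_Icc
  have hpos : Icc s (t + 1) ⊆ Ioi 0 := fun x hx => hs.trans_le hx.1
  have key : ∀ n, (∫ τ in Ioi (0 : ℝ), deriv (smoothStep s n) τ * p τ) -
      ∫ τ in Ioi (0 : ℝ), deriv (smoothStep t n) τ * p τ = -∫ τ in Ioi (0 : ℝ), η n τ * q τ := by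
    intro n
    rw [← h (η n) ((contDiff_smoothStep s n).sub (contDiff_smoothStep t n))
      (isCompact_Icc.of_isClosed_subset (isClosed_tsupport _) (hcs n)) ((hcs n).trans hpos),
      ← integral_sub (integrableOn_deriv_smoothStep_mul hp hs n)
      (integrableOn_deriv_smoothStep_mul hp (hs.trans_le hst) n)]
    refine integral_congr_ae (Eventually.of_forall fun τ => ?_)
    have := deriv_sub ((contDiff_smoothStep s n).differentiable (by simp) τ)
      ((contDiff_smoothStep t n).differentiable (by simp) τ)
    simp only [hη]
    rw [← sub_mul, ← this]
    rfl
  have lim1 := (tendsto_integral_deriv_smoothStep_mul hp hs).sub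
    (tendsto_integral_deriv_smoothStep_mul hp (hs.trans_le hst))
  have lim2 : Tendsto (fun n => ∫ τ in Ioi (0 : ℝ), η n τ * q τ) atTop
      (𝓝 (∫ τ in Ioi (0 : ℝ), (Ioc s t).indicator q τ)) := by
    refine tendsto_integral_of_dominated_convergence (fun τ => ‖(Icc s (t + 1)).indicator q τ‖)
      ?_ ?_ ?_ ?_
    · intro n
      have h1 : AEStronglyMeasurable (fun τ => η n τ * (Icc s (t + 1)).indicator q τ)
          (volume.restrict (Ioi 0)) := by
        refine AEStronglyMeasurable.mul ?_
          (hI.integrable_indicator measurableSet_Icc).aestronglyMeasurable.restrict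
        exact ((contDiff_smoothStep s n).continuous.sub
          (contDiff_smoothStep t n).continuous).aestronglyMeasurable
      refine h1.congr (Eventually.of_forall fun τ => ?_)
      by_cases hτ : τ ∈ Icc s (t + 1)
      · simp [hτ]
      · simp [hzero n τ hτ]
    · exact (hI.integrable_indicator measurableSet_Icc).norm.restrict
    · refine fun n => Eventually.of_forall fun τ => ?_
      by_cases hτ : τ ∈ Icc s (t + 1)
      · rw [indicator_of_mem hτ, norm_mul]
        refine mul_le_of_le_one_left (norm_nonneg _) ?_
        have a1 := Real.smoothTransition.nonneg (((n : ℝ) + 1) * (τ - s))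
        have a2 := Real.smoothTransition.le_one (((n : ℝ) + 1) * (τ - s))
        have a3 := Real.smoothTransition.nonneg (((n : ℝ) + 1) * (τ - t))
        have a4 := Real.smoothTransition.le_one (((n : ℝ) + 1) * (τ - t))
        rw [Real.norm_eq_abs, abs_le]
        simp only [hη, smoothStep]
        exact ⟨by linarith, by linarith⟩
      · simp [hzero n τ hτ]
    · refine Eventually.of_forall fun τ => ?_
      have ev : ∀ r, r < τ → ∀ᶠ n : ℕ in atTop, smoothStep r n τ = 1 := by
        intro r hr
        have h1 : Tendsto (fun n : ℕ => ((n : ℝ) + 1) * (τ - r)) atTop atTop :=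
          (tendsto_atTop_add_const_right _ _ tendsto_natCast_atTop_atTop).atTop_mul_const
            (by linarith)
        filter_upwards [h1.eventually_ge_atTop 1] with n hn using smoothStep_eq_one hn
      refine tendsto_const_nhds.congr' ?_
      rcases le_or_gt τ s with h1 | h1
      · refine Eventually.of_forall fun n => ?_
        have : τ ∉ Ioc s t := fun h' => absurd h'.1 (not_lt.2 h1)
        simp [this, hη, smoothStep_eq_zero h1, smoothStep_eq_zero (h1.trans hst)]
      rcases le_or_gt τ t with h2 | h2
      · filter_upwards [ev s h1] with n hn
        have : τ ∈ Ioc s t := ⟨h1, h2⟩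
        simp [this, hη, hn, smoothStep_eq_zero h2]
      · filter_upwards [ev s h1, ev t h2] with n hn hn'
        have : τ ∉ Ioc s t := fun h' => absurd h'.2 (not_le.2 h2)
        simp [this, hη, hn, hn']
  have lim3 := tendsto_nhds_unique (lim1.congr key) lim2.neg
  rw [setIntegral_indicator measurableSet_Ioc, inter_eq_right.2
    (show Ioc s t ⊆ Ioi 0 from fun x hx => hs.trans hx.1),
    ← intervalIntegral.integral_of_le hst] at lim3
  linarith

/-! ### Sobolev and Poincaré inequalities on the closure of the test fields -/

/-- Fatou's lemma along a subsequence that converges almost everywhere. -/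
theorem lowerSemicontinuous_eLpNorm {α E : Type*} [MeasurableSpace α] {μ : Measure α}
    [NormedAddCommGroup E] {p : ℝ≥0∞} [Fact (1 ≤ p)] (q : ℝ≥0∞) :
    LowerSemicontinuous fun f : Lp E p μ => eLpNorm f q μ := by
  rw [lowerSemicontinuous_iff_isClosed_preimage]
  refine fun K => isClosed_of_closure_subset fun f hf => ?_
  obtain ⟨F, hF, hlim⟩ := mem_closure_iff_seq_limit.1 hf
  have h1 := tendstoInMeasure_of_tendsto_Lp hlim
  obtain ⟨ns, -, hns⟩ := h1.exists_seq_tendsto_ae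
  exact Lp.eLpNorm_le_of_ae_tendsto (Eventually.of_forall fun n => hF (ns n))
    (fun n => Lp.aestronglyMeasurable _) hns

/-- By Cauchy–Schwarz. The Sobolev inequality is available for the operator norm, whereas `V` is
built with the Frobenius norm. -/
theorem opNorm_le_norm_gradField (φ : E3 → E3) (x : E3) : ‖fderiv ℝ φ x‖ ≤ ‖gradField φ x‖ := by
  refine ContinuousLinearMap.opNorm_le_bound _ (norm_nonneg _) fun v => ?_
  have hv : v = ∑ i, v i • EuclideanSpace.single i (1 : ℝ) := by
    ext k
    simp [Finset.sum_apply, Pi.single_apply]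
  have h1 : ∀ j, fderiv ℝ φ x v j = ∑ i, v i * partialDeriv φ i j x := by
    intro j
    conv_lhs => rw [hv]
    simp [partialDeriv]
  refine le_of_sq_le_sq ?_ (by positivity)
  rw [mul_pow, EuclideanSpace.norm_sq_eq, EuclideanSpace.norm_sq_eq, EuclideanSpace.norm_sq_eq,
    Fintype.sum_prod_type_right, Finset.sum_mul]
  refine Finset.sum_le_sum fun j _ => ?_
  rw [h1]
  simp only [Real.norm_eq_abs, sq_abs, gradField]
  refine (Finset.sum_mul_sq_le_sq_mul_sq _ _ _).trans_eq ?_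
  rw [mul_comm]

theorem IsTestField.support_subset' {Ω : Set E3} {φ : E3 → E3} (hφ : IsTestField Ω φ) :
    Function.support φ ⊆ Ω := (subset_tsupport _).trans hφ.support_subset

theorem IsTestField.partialDeriv_eq_zero {Ω : Set E3} {φ : E3 → E3} (hφ : IsTestField Ω φ)
    {x : E3} (hx : x ∉ Ω) (i j : Fin 3) : partialDeriv φ i j x = 0 := by
  have h : fderiv ℝ φ x = 0 := by
    by_contra h
    exact hx (hφ.support_subset (support_fderiv_subset ℝ h))
  simp [partialDeriv, h]

theorem IsTestField.support_gradField {Ω : Set E3} {φ : E3 → E3} (hφ : IsTestField Ω φ) :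
    Function.support (gradField φ) ⊆ Ω := by
  intro x hx
  by_contra h
  refine hx ?_
  ext ij
  simp [gradField, hφ.partialDeriv_eq_zero h]

variable {Ω : Set E3}

/-- The critical exponent in dimension three is `6`, as `1/2 - 1/3 = 1/6`; boundedness of `Ω` gives
the smaller exponents. -/
theorem exists_eLpNorm_le_of_isTestField (hΩ : Bornology.IsBounded Ω) {q : ℝ≥0}
    (hq : (6 : ℝ)⁻¹ ≤ (q : ℝ)⁻¹) :
    ∃ C : ℝ≥0, ∀ φ : E3 → E3, IsTestField Ω φ →
      eLpNorm φ q volume ≤ C * eLpNorm (gradField φ) 2 volume := by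
  refine ⟨eLpNormLESNormFDerivOfLeConst E3 volume Ω 2 q, fun φ hφ => ?_⟩
  refine (eLpNorm_le_eLpNorm_fderiv_of_le volume (hφ.smooth.of_le (by simp))
    hφ.support_subset' (p := 2) (q := q) (by norm_num) (by simp; norm_num) ?_ hΩ).trans ?_
  · simp only [finrank_euclideanSpace, Fintype.card_fin]
    refine le_trans ?_ hq
    norm_num
  · gcongr
    exact eLpNorm_mono fun x => opNorm_le_norm_gradField φ x

/-- The inequality passes from test fields to their closure: its left side is lower semicontinuous
and its right side continuous in the `H¹`-norm. -/
theorem exists_eLpNorm_fieldV_le (hΩ : Bornology.IsBounded Ω) {q : ℝ≥0}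
    (hq : (6 : ℝ)⁻¹ ≤ (q : ℝ)⁻¹) :
    ∃ C : ℝ≥0, ∀ φ : SpaceV Ω,
      eLpNorm (fieldV φ) q (volume.restrict Ω) ≤ C * ‖gradV φ‖ₑ := by
  obtain ⟨C, hC⟩ := exists_eLpNorm_le_of_isTestField hΩ hq
  refine ⟨C, fun φ => ?_⟩
  have hclosed : IsClosed {p : Pairs Ω |
      eLpNorm p.fst q (volume.restrict Ω) ≤ C * ‖p.snd‖ₑ} := by
    have h1 := (lowerSemicontinuous_eLpNorm (μ := volume.restrict Ω) (E := E3) (p := 2)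
      (q : ℝ≥0∞)).isClosed_epigraph
    have h2 : Continuous fun p : Pairs Ω => (p.fst, (C : ℝ≥0∞) * ‖p.snd‖ₑ) := by
      refine Continuous.prodMk ((WithLp.fstL 2 ℝ (L2 Ω) (L2Mat Ω)).continuous) ?_
      exact (ENNReal.continuous_const_mul ENNReal.coe_ne_top).comp
        ((WithLp.sndL 2 ℝ (L2 Ω) (L2Mat Ω)).continuous.enorm)
    exact h1.preimage h2
  refine closure_minimal (s := (testSpace Ω : Set (Pairs Ω))) ?_ hclosed φ.2
  rintro p ⟨ψ, hψ, h1, h2⟩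
  rw [mem_ofPred_eq]
  rw [Lp.enorm_def, eLpNorm_congr_ae h1, eLpNorm_congr_ae h2,
    eLpNorm_restrict_eq_of_support_subset hψ.support_subset',
    eLpNorm_restrict_eq_of_support_subset hψ.support_gradField]
  exact hC ψ hψ

/-- Poincaré's inequality. -/
theorem exists_norm_fieldV_le (hΩ : Bornology.IsBounded Ω) :
    ∃ C : ℝ, 0 ≤ C ∧ ∀ φ : SpaceV Ω, ‖fieldV φ‖ ≤ C * ‖gradV φ‖ := by
  obtain ⟨C, hC⟩ := exists_eLpNorm_fieldV_le hΩ (q := 2) (by norm_num)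
  refine ⟨C, C.2, fun φ => ?_⟩
  have := hC φ
  rw [ENNReal.coe_ofNat, ← Lp.enorm_def] at this
  simpa using ENNReal.toReal_mono (by finiteness) this

theorem norm_sq_spaceV (φ : SpaceV Ω) : ‖φ‖ ^ 2 = ‖fieldV φ‖ ^ 2 + ‖gradV φ‖ ^ 2 :=
  WithLp.prod_norm_sq_eq_of_L2 (φ.1 : Pairs Ω)

/-! ### The trilinear form as a continuous trilinear map -/

theorem norm_tensor (a c : E3) :
    ‖(WithLp.toLp 2 (fun ij : Fin 3 × Fin 3 => a ij.1 * c ij.2) : M33)‖ = ‖a‖ * ‖c‖ := by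
  rw [← sq_eq_sq₀ (norm_nonneg _) (by positivity), mul_pow, EuclideanSpace.norm_sq_eq,
    EuclideanSpace.norm_sq_eq, EuclideanSpace.norm_sq_eq, Fintype.sum_prod_type, Finset.sum_mul_sum]
  simp [mul_pow]

/-- The tensor product `(a, c) ↦ (aᵢ cⱼ)`. -/
noncomputable def tensor : E3 →L[ℝ] E3 →L[ℝ] M33 :=
  LinearMap.mkContinuous₂
    (LinearMap.mk₂ ℝ (fun a c => WithLp.toLp 2 (fun ij : Fin 3 × Fin 3 => a ij.1 * c ij.2))
      (fun a a' c => by ext ij; simp [add_mul]) (fun r a c => by ext ij; simp [mul_assoc])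
      (fun a c c' => by ext ij; simp [mul_add]) (fun r a c => by ext ij; simp [mul_left_comm]))
    1 (fun a c => by rw [one_mul]; exact (norm_tensor a c).le)

theorem tensor_apply (a c : E3) (ij : Fin 3 × Fin 3) : tensor a c ij = a ij.1 * c ij.2 := rfl

theorem norm_tensor_apply (a c : E3) : ‖tensor a c‖ = ‖a‖ * ‖c‖ := norm_tensor a c

theorem inner_tensor (a c : E3) (G : M33) :
    inner ℝ G (tensor a c) = ∑ i, ∑ j, a i * G (i, j) * c j := by
  rw [PiLp.inner_apply, Fintype.sum_prod_type]
  refine Finset.sum_congr rfl fun i _ => Finset.sum_congr rfl fun j _ => ?_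
  simp [tensor_apply]
  ring

instance : Fact ((1 : ℝ≥0∞) ≤ 4) := ⟨by norm_num⟩

instance : ENNReal.HolderTriple 4 4 2 := ⟨by
  rw [← two_mul, show (4 : ℝ≥0∞) = 2 * 2 by norm_num, ENNReal.mul_inv (by simp) (by simp),
    ← mul_assoc, ENNReal.mul_inv_cancel (by simp) (by simp), one_mul]⟩

theorem memLp_four (hΩ : Bornology.IsBounded Ω) (φ : SpaceV Ω) :
    MemLp (fieldV φ) 4 (volume.restrict Ω) := by
  obtain ⟨C, hC⟩ := exists_eLpNorm_fieldV_le hΩ (q := 4) (by norm_num)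
  refine ⟨Lp.aestronglyMeasurable _, (hC φ).trans_lt ?_⟩
  exact ENNReal.mul_lt_top ENNReal.coe_lt_top enorm_lt_top

theorem norm_gradV_le (φ : SpaceV Ω) : ‖gradV φ‖ ≤ ‖φ‖ := by
  have := norm_sq_spaceV φ
  exact le_of_sq_le_sq (by nlinarith [sq_nonneg ‖fieldV φ‖]) (norm_nonneg _)

/-- The embedding of `V` into `L⁴`. -/
theorem exists_embedding_four (hΩ : Bornology.IsBounded Ω) :
    ∃ J : SpaceV Ω →L[ℝ] Lp E3 4 (volume.restrict Ω),
      ∀ φ, J φ =ᵐ[volume.restrict Ω] fieldV φ := by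
  obtain ⟨C, hC⟩ := exists_eLpNorm_fieldV_le hΩ (q := 4) (by norm_num)
  let J₀ : SpaceV Ω →ₗ[ℝ] Lp E3 4 (volume.restrict Ω) :=
    { toFun := fun φ => (memLp_four hΩ φ).toLp _
      map_add' := fun φ ψ => by
        rw [← MemLp.toLp_add]
        refine MemLp.toLp_congr _ _ ?_
        rw [map_add]
        exact Lp.coeFn_add _ _
      map_smul' := fun r φ => by
        rw [RingHom.id_apply, ← MemLp.toLp_const_smul]
        refine MemLp.toLp_congr _ _ ?_
        rw [map_smul]
        exact Lp.coeFn_smul _ _ }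
  refine ⟨J₀.mkContinuous C fun φ => ?_, fun φ => MemLp.coeFn_toLp (memLp_four hΩ φ)⟩
  change ‖(memLp_four hΩ φ).toLp _‖ ≤ _
  rw [Lp.norm_toLp]
  refine (ENNReal.toReal_mono (by finiteness) (hC φ)).trans ?_
  rw [ENNReal.toReal_mul, toReal_enorm, ENNReal.coe_toReal]
  gcongr
  exact norm_gradV_le φ

/-- `b(u,v,w)` is the `L²` pairing of `∇v` with `u ⊗ w`, and the tensor product maps `L⁴ × L⁴` into
`L²`. -/
theorem exists_continuous_trilinear (hΩ : Bornology.IsBounded Ω) :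
    ∃ b : SpaceV Ω →L[ℝ] SpaceV Ω →L[ℝ] SpaceV Ω →L[ℝ] ℝ,
      ∀ u v w, b u v w = trilinear u v w := by
  obtain ⟨J, hJ⟩ := exists_embedding_four hΩ
  let K : SpaceV Ω →L[ℝ] SpaceV Ω →L[ℝ] L2Mat Ω :=
    (tensor.holderL (volume.restrict Ω) 4 4 2).bilinearComp J J
  let g : SpaceV Ω →L[ℝ] L2Mat Ω →L[ℝ] ℝ := (innerSL ℝ).comp gradV
  let b : SpaceV Ω →L[ℝ] SpaceV Ω →L[ℝ] SpaceV Ω →L[ℝ] ℝ :=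
    ((ContinuousLinearMap.compL ℝ (SpaceV Ω) (L2Mat Ω →L[ℝ] ℝ) (SpaceV Ω →L[ℝ] ℝ)).flip g).comp
      ((ContinuousLinearMap.compL ℝ (SpaceV Ω) (L2Mat Ω) ℝ).flip.comp K)
  refine ⟨b, fun u v w => ?_⟩
  change inner ℝ (gradV v) (tensor.holder 2 (J u) (J w)) = _
  rw [L2.inner_def, trilinear]
  refine integral_congr_ae ?_
  filter_upwards [tensor.coeFn_holder (r := 2) (J u) (J w), hJ u, hJ w] with x h1 h2 h3
  rw [h1, h2, h3, inner_tensor]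

/-! ### Antisymmetry -/

/-- Integration by parts moves the derivatives onto `φ`, whose divergence vanishes. -/
theorem integral_advection_eq_zero {φ : E3 → E3} {s : E3 → ℝ} (hφ : IsTestField Ω φ)
    (hs : ContDiff ℝ 1 s) :
    ∫ x, ∑ i, φ x i * fderiv ℝ s x (EuclideanSpace.single i 1) = 0 := by
  have hφi : ∀ i, ContDiff ℝ 1 fun x => φ x i := fun i =>
    (contDiff_euclidean.1 (hφ.smooth.of_le (by simp))) i
  have hci : ∀ i, HasCompactSupport fun x => φ x i := fun i =>
    hφ.compactSupport.comp_left (g := fun y : E3 => y i) rfl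
  have hd : ∀ i x, fderiv ℝ (fun x => φ x i) x (EuclideanSpace.single i 1) =
      partialDeriv φ i i x := by
    intro i x
    have h1 : HasFDerivAt φ (fderiv ℝ φ x) x :=
      (hφ.smooth.differentiable (by simp) x).hasFDerivAt
    have h2 := ((EuclideanSpace.proj i : E3 →L[ℝ] ℝ).hasFDerivAt).comp x h1
    have h3 : fderiv ℝ (fun x => φ x i) x =
        (EuclideanSpace.proj i : E3 →L[ℝ] ℝ).comp (fderiv ℝ φ x) := h2.fderiv
    rw [h3]
    rfl
  have hsc : ∀ i : Fin 3, Continuous fun x => fderiv ℝ s x (EuclideanSpace.single i 1) := fun i =>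
    (hs.continuous_fderiv (by simp)).clm_apply continuous_const
  have hφc : ∀ i : Fin 3, Continuous fun x =>
      fderiv ℝ (fun x => φ x i) x (EuclideanSpace.single i 1) := fun i =>
    ((hφi i).continuous_fderiv (by simp)).clm_apply continuous_const
  have hcd : ∀ i : Fin 3, HasCompactSupport fun x =>
      fderiv ℝ (fun x => φ x i) x (EuclideanSpace.single i 1) := fun i =>
    (hci i).fderiv_apply ℝ _
  have i1 : ∀ i : Fin 3, Integrable fun x => φ x i * fderiv ℝ s x (EuclideanSpace.single i 1) :=
    fun i => ((hφi i).continuous.mul (hsc i)).integrable_of_hasCompactSupport ((hci i).mul_right)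
  have i2 : ∀ i : Fin 3, Integrable fun x =>
      fderiv ℝ (fun x => φ x i) x (EuclideanSpace.single i 1) * s x :=
    fun i => ((hφc i).mul hs.continuous).integrable_of_hasCompactSupport ((hcd i).mul_right)
  rw [integral_finsetSum _ fun i _ => i1 i]
  have hpart : ∀ i : Fin 3, ∫ x, φ x i * fderiv ℝ s x (EuclideanSpace.single i 1) =
      -∫ x, fderiv ℝ (fun x => φ x i) x (EuclideanSpace.single i 1) * s x := fun i =>
    integral_mul_fderiv_eq_neg_fderiv_mul_of_integrable (i2 i) (i1 i)
      (((hφi i).continuous.mul hs.continuous).integrable_of_hasCompactSupport ((hci i).mul_right))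
      (fun x _ => (hφi i).differentiable (by simp) x) (fun x _ => hs.differentiable (by simp) x)
  simp_rw [hpart]
  rw [Finset.sum_neg_distrib, ← integral_finsetSum _ fun i _ => i2 i, neg_eq_zero]
  simp_rw [hd, ← Finset.sum_mul, hφ.div_free, zero_mul]
  simp

/-- The integrand is `φ · ∇(ψ · χ)` by the product rule. -/
theorem integral_trilinear_antisymm {φ ψ χ : E3 → E3} (hφ : IsTestField Ω φ)
    (hψ : IsTestField Ω ψ) (hχ : IsTestField Ω χ) :
    ∫ x in Ω, ((∑ i, ∑ j, φ x i * partialDeriv ψ i j x * χ x j) +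
      ∑ i, ∑ j, φ x i * partialDeriv χ i j x * ψ x j) = 0 := by
  rw [setIntegral_eq_integral_of_forall_compl_eq_zero]
  · have hs : ContDiff ℝ 1 fun x => (inner ℝ (ψ x) (χ x) : ℝ) :=
      (hψ.smooth.of_le (by simp)).inner ℝ (hχ.smooth.of_le (by simp))
    rw [← integral_advection_eq_zero hφ hs]
    refine integral_congr_ae (Eventually.of_forall fun x => ?_)
    dsimp only
    rw [← Finset.sum_add_distrib]
    refine Finset.sum_congr rfl fun i _ => ?_
    rw [fderiv_inner_apply ℝ (hψ.smooth.differentiable (by simp) x)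
      (hχ.smooth.differentiable (by simp) x), ← Finset.sum_add_distrib, PiLp.inner_apply,
      PiLp.inner_apply, ← Finset.sum_add_distrib, Finset.mul_sum]
    refine Finset.sum_congr rfl fun j _ => ?_
    simp only [RCLike.inner_apply, conj_trivial, partialDeriv]
    ring
  · intro x hx
    have : ∀ i, φ x i = 0 := fun i => by
      have : φ x = 0 := by
        by_contra h
        exact hx (hφ.support_subset' h)
      simp [this]
    simp [this]

/-- A test field as an element of `V`. -/
noncomputable def ofTestSpace (p : testSpace Ω) : SpaceV Ω :=
  (⟨p.1, (testSpace Ω).le_topologicalClosure p.2⟩ : closureV Ω)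

theorem denseRange_ofTestSpace : DenseRange (ofTestSpace (Ω := Ω)) :=
  (denseRange_inclusion_iff (s := (testSpace Ω : Set (Pairs Ω))) subset_closure).2 subset_rfl

/-- Both sides are continuous on `V`, where test fields are dense. -/
theorem trilinear_antisymm (hΩ : Bornology.IsBounded Ω) (u v w : SpaceV Ω) :
    trilinear u v w = -trilinear u w v := by
  obtain ⟨b, hb⟩ := exists_continuous_trilinear hΩ
  simp_rw [← hb]
  refine isClosed_property3 (p := fun u v w => b u v w = -b u w v) denseRange_ofTestSpace
    (isClosed_eq (by fun_prop) (by fun_prop)) ?_ u v w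
  rintro ⟨p, φ, hφ, hp, -⟩ ⟨q, ψ, hψ, hq, hq'⟩ ⟨r, χ, hχ, hr, hr'⟩
  rw [hb, hb, eq_neg_iff_add_eq_zero]
  have hint : ∀ {φ ψ χ : E3 → E3}, IsTestField Ω φ → IsTestField Ω ψ → IsTestField Ω χ →
      IntegrableOn (fun x => ∑ i, ∑ j, φ x i * partialDeriv ψ i j x * χ x j) Ω := by
    intro φ ψ χ hφ hψ hχ
    refine Integrable.integrableOn ?_
    refine integrable_finsetSum _ fun i _ => integrable_finsetSum _ fun j _ => ?_
    refine Continuous.integrable_of_hasCompactSupport ?_ ?_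
    · have h1 : Continuous fun x => fderiv ℝ ψ x (EuclideanSpace.single i 1) :=
        (hψ.smooth.continuous_fderiv (by simp)).clm_apply continuous_const
      have h2 := hφ.smooth.continuous
      have h3 := hχ.smooth.continuous
      unfold partialDeriv
      fun_prop
    · exact (hχ.compactSupport.comp_left (g := fun y : E3 => y j) rfl).mul_left
  have key := integral_trilinear_antisymm hφ hψ hχ
  rw [integral_add (hint hφ hψ hχ) (hint hφ hχ hψ)] at key
  refine Eq.trans (congrArg₂ (· + ·) ?_ ?_) key <;> refine integral_congr_ae ?_
  · filter_upwards [hp, hq', hr] with x h1 h2 h3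
    change ∑ i, ∑ j, p.fst x i * q.snd x (i, j) * r.fst x j = _
    rw [h1, h2, h3]
    rfl
  · filter_upwards [hp, hq, hr'] with x h1 h2 h3
    change ∑ i, ∑ j, p.fst x i * r.snd x (i, j) * q.fst x j = _
    rw [h1, h2, h3]
    rfl

/-! ### Fields with bounded gradient -/

theorem abs_trilinear_le (u v w : SpaceV Ω) (hv : gradSup v ≠ ⊤) :
    |trilinear u v w| ≤ (gradSup v).toReal * ‖fieldV u‖ * ‖fieldV w‖ := by
  have h1 : ‖trilinear u v w‖ₑ ≤ gradSup v * (‖fieldV u‖ₑ * ‖fieldV w‖ₑ) := by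
    refine (enorm_integral_le_lintegral_enorm _).trans ?_
    have h2 := ENNReal.lintegral_mul_le_Lp_mul_Lq (volume.restrict Ω) Real.HolderConjugate.two_two
      (Lp.aestronglyMeasurable (fieldV u)).enorm (Lp.aestronglyMeasurable (fieldV w)).enorm
    have h3 : ∫⁻ x in Ω, ‖fieldV u x‖ₑ * ‖fieldV w x‖ₑ ≤ ‖fieldV u‖ₑ * ‖fieldV w‖ₑ := by
      simpa [Lp.enorm_def, eLpNorm_eq_lintegral_rpow_enorm_toReal] using h2
    refine le_trans ?_ (mul_le_mul_right h3 (gradSup v))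
    rw [← lintegral_const_mul' _ _ hv]
    refine lintegral_mono_ae ?_
    have h4 : ∀ᵐ x ∂(volume.restrict Ω), ‖gradV v x‖ₑ ≤ gradSup v := by
      rw [gradSup, eLpNorm_exponent_top]
      exact enorm_ae_le_eLpNormEssSup _ _
    filter_upwards [h4] with x hx
    rw [← inner_tensor]
    calc ‖inner ℝ (gradV v x) (tensor (fieldV u x) (fieldV w x))‖ₑ
        ≤ ‖gradV v x‖ₑ * ‖tensor (fieldV u x) (fieldV w x)‖ₑ :=
          enorm_le_mul_enorm (norm_inner_le_norm _ _)
      _ ≤ ‖gradV v x‖ₑ * (‖fieldV u x‖ₑ * ‖fieldV w x‖ₑ) := by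
          gcongr
          exact enorm_le_mul_enorm (norm_tensor_apply _ _).le
      _ ≤ _ := by gcongr
  have h2 := ENNReal.toReal_mono (by finiteness) h1
  simpa [mul_assoc] using h2

theorem lowerSemicontinuous_gradSup : LowerSemicontinuous (gradSup : SpaceV Ω → ℝ≥0∞) := by
  have h := lowerSemicontinuous_eLpNorm (μ := volume.restrict Ω) (E := M33) (p := 2) ⊤
  rw [lowerSemicontinuous_iff_isClosed_preimage] at h ⊢
  exact fun y => (h y).preimage gradV.continuous

/-! ### Weak solutions as evolutions; the energy inequality for a difference -/

theorem fieldV_mem_spaceH (φ : SpaceV Ω) : fieldV φ ∈ SpaceH Ω := by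
  have hφ : (φ.1 : Pairs Ω) ∈ closure (testSpace Ω : Set (Pairs Ω)) := φ.2
  have h : WithLp.fstL 2 ℝ (L2 Ω) (L2Mat Ω) φ.1 ∈ closure (((testSpace Ω).map
      (WithLp.fstL 2 ℝ (L2 Ω) (L2Mat Ω)).toLinearMap : Submodule ℝ (L2 Ω)) : Set (L2 Ω)) :=
    map_mem_closure (WithLp.fstL 2 ℝ (L2 Ω) (L2Mat Ω)).continuous hφ fun p hp =>
      Submodule.mem_map_of_mem (f := (WithLp.fstL 2 ℝ (L2 Ω) (L2Mat Ω)).toLinearMap) hp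
  exact h

/-- The inclusion of `V` into `H`. -/
noncomputable def inclusionH : SpaceV Ω →L[ℝ] SpaceH Ω :=
  fieldV.codRestrict (SpaceH Ω) fieldV_mem_spaceH

theorem norm_inclusionH (φ : SpaceV Ω) : ‖inclusionH φ‖ = ‖fieldV φ‖ := rfl

instance : CompleteSpace (SpaceH Ω) :=
  (Submodule.isClosed_topologicalClosure _).completeSpace_coe

/-- The Dirichlet form as an operator from `V` to its dual. -/
noncomputable def stokes : SpaceV Ω →L[ℝ] VDual Ω :=
  ((ContinuousLinearMap.compL ℝ (SpaceV Ω) (L2Mat Ω) ℝ).flip gradV).comp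
    ((innerSL ℝ).comp gradV)

theorem stokes_apply (φ ψ : SpaceV Ω) : stokes φ ψ = inner ℝ (gradV φ) (gradV ψ) := rfl

theorem exists_advectionForm (hΩ : Bornology.IsBounded Ω) :
    ∃ b : SpaceV Ω →L[ℝ] SpaceV Ω →L[ℝ] SpaceV Ω →L[ℝ] ℝ,
      (∀ u v w, b u v w = trilinear u v w) ∧ AdvectionForm inclusionH b gradSup := by
  obtain ⟨b, hb⟩ := exists_continuous_trilinear hΩ
  refine ⟨b, hb, ⟨fun u v w => ?_, fun u v w hv => ?_, lowerSemicontinuous_gradSup⟩⟩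
  · rw [hb, hb, trilinear_antisymm hΩ]
  · rw [hb]
    exact abs_trilinear_le u v w hv

variable {b : SpaceV Ω →L[ℝ] SpaceV Ω →L[ℝ] SpaceV Ω →L[ℝ] ℝ} {ν : ℝ} {f g : ℝ → VDual Ω}
  {u v : ℝ → SpaceH Ω} {uV vV : ℝ → SpaceV Ω}

/-- The viscous term is linear and lies in `L²(0,T;V')`, so it is counted as part of the force; only
advection needs special care. -/
theorem IsWeakSolution.exists_evolution (hb : ∀ u v w, b u v w = trilinear u v w)
    (hu : IsWeakSolution ν f u uV) (hf : IsForcing f) :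
    ∃ u', Evolution inclusionH b u uV (fun t => f t - ν • stokes (uV t)) u' := by
  obtain ⟨u', ⟨hloc, hder⟩, heq⟩ := hu.equation
  refine ⟨u', hu.weaklyContinuous, hu.memL2V, fun T hT => ?_, ?_, hloc, ?_, ?_⟩
  · exact (hf T hT).sub ((stokes.comp_memLp' (hu.memL2V T hT)).const_smul ν)
  · filter_upwards [(ae_restrict_iff' measurableSet_Ioi).1 hu.ae_eq] with t ht h0
    exact Subtype.ext (ht h0)
  · intro s t hs hst φ
    have hp : ContinuousOn (fun t => (inner ℝ (u t) (inclusionH φ) : ℝ)) (Ioi 0) :=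
      (hu.weaklyContinuous (inclusionH φ)).mono Ioi_subset_Ici_self
    refine sub_eq_integral_of_weak_deriv hp (q := fun τ => u' τ φ) ?_ ?_ hs hst
    · intro x hx
      obtain ⟨S, hS, hI⟩ := hloc x hx
      exact ⟨S, hS, hI.apply_continuousLinearMap φ⟩
    · intro η h1 h2 h3
      exact hder η h1 h2 h3 φ
  · filter_upwards [(ae_restrict_iff' measurableSet_Ioi).1 heq] with t ht h0 φ
    have := ht h0 φ
    rw [dirichlet, ← hb] at this
    simp only [sub_apply, smul_apply, stokes_apply, smul_eq_mul]
    linarith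

/-- The energy inequality for the difference of two weak solutions, one of which has an integrable
gradient bound. -/
theorem difference_energy (hb : ∀ u v w, b u v w = trilinear u v w)
    (hadv : AdvectionForm inclusionH b gradSup) (hf : IsForcing f) (hg : IsForcing g)
    (hu : IsWeakSolution ν f u uV) (hv : IsWeakSolution ν g v vV) (hE : EnergyInequality ν g v vV)
    {c d : ℝ} (hc : 0 < c) (hM : ∫⁻ τ in Ioo c d, gradSup (uV τ) ≠ ⊤) :
    IntegrableOn (fun τ => (f τ - g τ) (uV τ - vV τ) - ν * ‖gradV (uV τ - vV τ)‖ ^ 2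
      - b (uV τ - vV τ) (uV τ) (uV τ - vV τ)) (Ioo c d) ∧
    AEPairs c d fun s t => ‖u t - v t‖ ^ 2 / 2 ≤ ‖u s - v s‖ ^ 2 / 2 +
      ∫ τ in s..t, ((f τ - g τ) (uV τ - vV τ) - ν * ‖gradV (uV τ - vV τ)‖ ^ 2
        - b (uV τ - vV τ) (uV τ) (uV τ - vV τ)) := by
  obtain ⟨u', hu'⟩ := hu.exists_evolution hb hf
  obtain ⟨v', hv'⟩ := hv.exists_evolution hb hg
  -- Paired with itself, `u` satisfies an energy equality on the interval.
  have E1 := hu'.inner_sub_inner hadv hu' hc hM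
  have E2 := hu'.inner_sub_inner hadv hv' hc hM
  have I1 := hu'.integrableOn_deriv_apply_add hadv hu' hc hM
  have I2 := hu'.integrableOn_deriv_apply_add hadv hv' hc hM
  have hgm : MemLp g 2 (volume.restrict (Ioo c d)) :=
    (hg (max d 1) (by simp)).mono_measure (Measure.restrict_mono
      (show Ioo c d ⊆ Ioc 0 (max d 1) from
        fun _ h => ⟨hc.trans h.1, h.2.le.trans (le_max_left _ _)⟩) le_rfl)
  have I3 : IntegrableOn (fun τ => g τ (vV τ)) (Ioo c d) :=
    integrable_apply_of_memLp_two hgm (hv'.memLp_Ioo hc d)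
  have I4 : IntegrableOn (fun τ => ‖gradV (vV τ)‖ ^ 2) (Ioo c d) :=
    (gradV.comp_memLp' (hv'.memLp_Ioo hc d)).integrable_norm_pow (by simp)
  have E3' : AEPairs c d fun s t => ‖v t‖ ^ 2 / 2 + ν * ∫ τ in s..t, ‖gradV (vV τ)‖ ^ 2
      ≤ ‖v s‖ ^ 2 / 2 + ∫ τ in s..t, g τ (vV τ) :=
    ⟨_, (ae_restrict_iff' measurableSet_Ioi).1 hE, fun s hs t _ h1 h2 _ =>
      hs (hc.trans h1) t h2.le⟩
  -- The integrand of `½|u|² - ⟨u,v⟩ + ½|v|²`. By antisymmetry `b(u,u,u)` vanishes and the other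
  -- advection terms combine into `-b(w,u,w)` with `w = u - v`.
  have hR : ∀ᵐ τ, τ ∈ Ioo c d → (1 / 2 * (u' τ (uV τ) + u' τ (uV τ)) - (u' τ (vV τ) + v' τ (uV τ))
      + (g τ (vV τ) - ν * ‖gradV (vV τ)‖ ^ 2)) =
      (f τ - g τ) (uV τ - vV τ) - ν * ‖gradV (uV τ - vV τ)‖ ^ 2
        - b (uV τ - vV τ) (uV τ) (uV τ - vV τ) := by
    filter_upwards [hu'.equation, hv'.equation] with τ h1 h2 hτ
    have h0 : 0 < τ := hc.trans hτ.1
    have a1 := hadv.antisymm (uV τ) (uV τ) (uV τ)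
    have a2 := hadv.antisymm (vV τ) (uV τ) (uV τ)
    have a3 := hadv.antisymm (vV τ) (vV τ) (uV τ)
    have hn : ‖gradV (uV τ - vV τ)‖ ^ 2 = ‖gradV (uV τ)‖ ^ 2 - 2 * inner ℝ (gradV (uV τ))
        (gradV (vV τ)) + ‖gradV (vV τ)‖ ^ 2 := by
      rw [map_sub, norm_sub_sq_real]
    have hn1 : (inner ℝ (gradV (uV τ)) (gradV (uV τ)) : ℝ) = ‖gradV (uV τ)‖ ^ 2 :=
      real_inner_self_eq_norm_sq _
    have hn2 := real_inner_comm (gradV (uV τ)) (gradV (vV τ))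
    rw [hn, h1 h0, h1 h0, h2 h0]
    simp only [sub_apply, smul_apply, stokes_apply, smul_eq_mul, map_sub, hn1, hn2]
    linarith
  have IR := ((I1.const_mul (1 / 2)).sub I2).add (I3.sub (I4.const_mul ν))
  refine ⟨IR.congr ((ae_restrict_iff' measurableSet_Ioo).2 hR),
    ((E1.and E2).and E3').mono fun s t hs hst ht h => ?_⟩
  obtain ⟨⟨h1, h2⟩, h3⟩ := h
  have i1 := intervalIntegrable_of_integrableOn_Ioo I1 hs.le hst.le ht.le
  have i2 := intervalIntegrable_of_integrableOn_Ioo I2 hs.le hst.le ht.le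
  have i3 := intervalIntegrable_of_integrableOn_Ioo I3 hs.le hst.le ht.le
  have i4 := intervalIntegrable_of_integrableOn_Ioo I4 hs.le hst.le ht.le
  have hint : (∫ τ in s..t, ((f τ - g τ) (uV τ - vV τ) - ν * ‖gradV (uV τ - vV τ)‖ ^ 2
        - b (uV τ - vV τ) (uV τ) (uV τ - vV τ))) =
      1 / 2 * (∫ τ in s..t, (u' τ (uV τ) + u' τ (uV τ))) - (∫ τ in s..t, (u' τ (vV τ) + v' τ (uV τ)))
      + ((∫ τ in s..t, g τ (vV τ)) - ν * ∫ τ in s..t, ‖gradV (vV τ)‖ ^ 2) := by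
    rw [← intervalIntegral.integral_const_mul, ← intervalIntegral.integral_const_mul,
      ← intervalIntegral.integral_sub (i1.const_mul _) i2,
      ← intervalIntegral.integral_sub i3 (i4.const_mul _),
      ← intervalIntegral.integral_add ((i1.const_mul _).sub i2) (i3.sub (i4.const_mul _))]
    refine intervalIntegral.integral_congr_ae ?_
    rw [uIoc_of_le hst.le]
    filter_upwards [hR] with τ hτ h
    exact (hτ ⟨hs.trans h.1, h.2.trans_lt ht⟩).symm
  rw [hint, ← h1, ← h2, norm_sub_sq_real, norm_sub_sq_real, real_inner_self_eq_norm_sq,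
    real_inner_self_eq_norm_sq]
  linarith

/-! ### Decay -/

/-- Cover `(t, t']` by windows of length `T`; the extra `κ * T` pays for the last, incomplete
window. -/
theorem lintegral_Ioc_le_of_mean {G : ℝ → ℝ≥0∞} {T κ t₀ : ℝ} (hT : 0 < T) (hκ : 0 ≤ κ)
    (h : ∀ t, t₀ ≤ t → ∫⁻ s in Ioc t (t + T), G s ≤ ENNReal.ofReal (κ * T)) {t t' : ℝ}
    (ht : t₀ ≤ t) (htt' : t ≤ t') :
    ∫⁻ s in Ioc t t', G s ≤ ENNReal.ofReal (κ * (t' - t) + κ * T) := by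
  have step : ∀ n : ℕ, ∫⁻ s in Ioc t (t + n * T), G s ≤ ENNReal.ofReal (n * (κ * T)) := by
    intro n
    induction n with
    | zero => simp
    | succ n ih =>
      have h1 : Ioc t (t + (n + 1 : ℕ) * T) = Ioc t (t + n * T) ∪ Ioc (t + n * T) (t + n * T + T) := by
        rw [Ioc_union_Ioc_eq_Ioc (by nlinarith [n.cast_nonneg (α := ℝ)]) (by linarith)]
        push_cast; ring_nf
      rw [h1]
      refine (lintegral_union_le _ _ _).trans ?_
      refine (add_le_add ih (h _ (by nlinarith [n.cast_nonneg (α := ℝ)]))).trans_eq ?_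
      rw [← ENNReal.ofReal_add (by positivity) (by positivity)]
      congr 1; push_cast; ring
  have h0 : 0 ≤ (t' - t) / T := div_nonneg (by linarith) hT.le
  have h1 := Nat.le_ceil ((t' - t) / T)
  have h2 := (Nat.ceil_lt_add_one h0).le
  rw [div_le_iff₀ hT] at h1
  calc ∫⁻ s in Ioc t t', G s ≤ ∫⁻ s in Ioc t (t + ⌈(t' - t) / T⌉₊ * T), G s :=
        lintegral_mono_set (Ioc_subset_Ioc_right (by linarith))
    _ ≤ _ := step _
    _ ≤ _ := by
        refine ENNReal.ofReal_le_ofReal ?_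
        calc _ ≤ ((t' - t) / T + 1) * (κ * T) := by gcongr
          _ = _ := by field_simp

/-- A nearly optimal window length `T`. The strict inequality leaves room for a `κ` below `A` that
bounds all late window means. -/
theorem exists_lintegral_gradSup_le {Ω : Set E3} {uV : ℝ → SpaceV Ω} {A : ℝ}
    (hfin : meanGradSup uV < ⊤) (h : (meanGradSup uV).toReal < A) :
    ∃ T κ t₀ : ℝ, 0 < T ∧ 0 ≤ κ ∧ κ < A ∧ 0 < t₀ ∧
      ∀ t, t₀ ≤ t → ∫⁻ s in Ioc t (t + T), gradSup (uV s) ≤ ENNReal.ofReal (κ * T) := by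
  rw [← ENNReal.lt_ofReal_iff_toReal_lt hfin.ne] at h
  rw [meanGradSup] at h
  simp only [iInf_lt_iff] at h
  obtain ⟨T, hT, h⟩ := h
  obtain ⟨k, hk1, hk2⟩ := exists_between h
  have hev := eventually_lt_of_limsup_lt hk1
  obtain ⟨t₁, ht₁⟩ := eventually_atTop.1 hev
  have hkt : k ≠ ⊤ := hk2.ne_top
  refine ⟨T, k.toReal, max t₁ 1, hT, ENNReal.toReal_nonneg,
    (ENNReal.lt_ofReal_iff_toReal_lt hkt).1 hk2, by positivity, fun t ht => ?_⟩
  have h1 := (ht₁ t ((le_max_left _ _).trans ht)).le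
  have hT' : ENNReal.ofReal T ≠ 0 := by simpa using hT
  rw [one_div, ENNReal.ofReal_inv_of_pos hT, mul_comm, ← div_eq_mul_inv,
    ENNReal.div_le_iff hT' ENNReal.ofReal_ne_top] at h1
  rwa [ENNReal.ofReal_mul ENNReal.toReal_nonneg, ENNReal.ofReal_toReal hkt]

/-- Grönwall's inequality on a half-line, for a coefficient whose means are bounded below. -/
theorem decay_of_mean {y m : ℝ → ℝ} {c α κ K ε : ℝ} (hα : 2 * κ < α) (hε : 0 ≤ ε)
    (hm : ∀ d, IntegrableOn m (Ioo c d))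
    (hmean : ∀ s t, c ≤ s → s ≤ t → ∫ τ in s..t, m τ ≤ κ * (t - s) + K)
    (hy : ∀ d, AEStronglyMeasurable y (volume.restrict (Ioo c d)))
    (hY : ∀ d, ∃ Y, ∀ τ ∈ Ioo c d, 0 ≤ y τ ∧ y τ ≤ Y)
    (H : ∀ d, AEPairs c d fun s t => y t ≤ y s + ∫ τ in s..t, (ε - (α - 2 * m τ) * y τ)) :
    ∀ᵐ s, c < s → ∀ᵐ t, s < t → y t ≤
      Real.exp (2 * K) * (Real.exp (-((α - 2 * κ) * (t - s))) * y s + ε / (α - 2 * κ)) := by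
  set μ := α - 2 * κ with hμ
  have hμ0 : 0 < μ := by rw [hμ]; linarith
  have ha : ∀ d, IntegrableOn (fun τ => α - 2 * m τ) (Ioo c d) := fun d =>
    Integrable.sub (integrableOn_const (by simp)) ((hm d).const_mul 2)
  have hpairs := AEPairs.of_forall_nat (c := c) fun n : ℕ =>
    AEPairs.gronwall (ha n) (hy n) (hY n).choose_spec (H n)
  have hae : ∀ᵐ s, ∀ n : ℕ, c < s → ∀ᵐ t, s < t → t < n → _ :=
    ae_all_iff.2 fun n : ℕ => (hpairs n).ae_ae
  filter_upwards [hae] with s hs hcs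
  have hs' := ae_all_iff.2 fun n => hs n hcs
  filter_upwards [hs'] with t ht hst
  obtain ⟨n, hn⟩ := exists_nat_gt t
  have key := ht n hst hn
  set A : ℝ → ℝ := fun τ => ∫ x in c..τ, (α - 2 * m x) with hA
  change y t * Real.exp (A t) ≤ y s * Real.exp (A s) + ε * ∫ τ in s..t, Real.exp (A τ) at key
  have hmI : ∀ {p q}, c ≤ p → p ≤ q → IntervalIntegrable m volume p q := fun h1 h2 =>
    intervalIntegrable_of_integrableOn_Ioo (hm _) h1 h2 le_rfl
  have haI : ∀ {p q}, c ≤ p → p ≤ q → IntervalIntegrable (fun τ => α - 2 * m τ) volume p q :=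
    fun h1 h2 => intervalIntegrable_of_integrableOn_Ioo (ha _) h1 h2 le_rfl
  -- The coefficient may be negative on parts of the interval; the mean bound still makes its
  -- primitive grow at rate `μ`, up to the loss `2 * K`.
  have hAdiff : ∀ τ, c ≤ τ → τ ≤ t → A τ ≤ A t + 2 * K - μ * (t - τ) := by
    intro τ h1 h2
    have e1 : A t - A τ = ∫ x in τ..t, (α - 2 * m x) :=
      intervalIntegral.integral_interval_sub_left (haI le_rfl (h1.trans h2)) (haI le_rfl h1)
    rw [intervalIntegral.integral_sub intervalIntegrable_const ((hmI h1 h2).const_mul 2),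
      intervalIntegral.integral_const_mul, intervalIntegral.integral_const, smul_eq_mul] at e1
    have := hmean τ t h1 h2
    rw [hμ]
    linarith
  have hexp : ∀ τ, c ≤ τ → τ ≤ t → Real.exp (A τ) ≤
      Real.exp (A t) * (Real.exp (2 * K) * Real.exp (-(μ * (t - τ)))) := by
    intro τ h1 h2
    rw [← Real.exp_add, ← Real.exp_add]
    exact Real.exp_le_exp.2 (by linarith [hAdiff τ h1 h2])
  have hAc : ContinuousOn A (Icc s t) := by
    have := intervalIntegral.continuousOn_primitive_interval (μ := volume)
      (f := fun x => α - 2 * m x) (a := c) (b := t)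
      (by
        rw [uIcc_of_le (hcs.trans hst).le, integrableOn_Icc_iff_integrableOn_Ioo]
        exact ha t)
    rw [uIcc_of_le (hcs.trans hst).le] at this
    exact this.mono (Icc_subset_Icc_left hcs.le)
  have hder : ∀ τ, HasDerivAt (fun τ => Real.exp (-(μ * (t - τ))) / μ)
      (Real.exp (-(μ * (t - τ)))) τ := by
    intro τ
    have h1 : HasDerivAt (fun τ : ℝ => -(μ * (t - τ))) μ τ := by
      simpa using (((hasDerivAt_id τ).const_sub t).const_mul μ).fun_neg
    simpa [hμ0.ne'] using h1.exp.div_const μ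
  have hint : ∫ τ in s..t, Real.exp (A τ) ≤ Real.exp (A t) * (Real.exp (2 * K) * (1 / μ)) := by
    have c1 : Continuous fun τ => Real.exp (-(μ * (t - τ))) := by fun_prop
    calc ∫ τ in s..t, Real.exp (A τ)
        ≤ ∫ τ in s..t, Real.exp (A t) * (Real.exp (2 * K) * Real.exp (-(μ * (t - τ)))) := by
          refine intervalIntegral.integral_mono_on hst.le ?_ ?_ fun τ hτ =>
            hexp τ (hcs.le.trans hτ.1) hτ.2
          · exact (hAc.rexp).intervalIntegrable_of_Icc hst.le
          · exact (Continuous.intervalIntegrable (by fun_prop) _ _)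
      _ = Real.exp (A t) * (Real.exp (2 * K) * (1 / μ - Real.exp (-(μ * (t - s))) / μ)) := by
          rw [intervalIntegral.integral_const_mul, intervalIntegral.integral_const_mul,
            intervalIntegral.integral_eq_sub_of_hasDerivAt (fun τ _ => hder τ)
            (c1.intervalIntegrable _ _)]
          simp
      _ ≤ _ := by
          gcongr
          exact sub_le_self _ (by positivity)
  have hys : 0 ≤ y s := by
    obtain ⟨Y, hY⟩ := hY t
    exact (hY s ⟨hcs, hst⟩).1
  have e2 := mul_le_mul_of_nonneg_left (hexp s hcs.le hst.le) hys
  have e3 := mul_le_mul_of_nonneg_left hint hε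
  refine le_of_mul_le_mul_right ?_ (Real.exp_pos (A t))
  calc y t * Real.exp (A t) ≤ _ := key
    _ ≤ y s * (Real.exp (A t) * (Real.exp (2 * K) * Real.exp (-(μ * (t - s))))) +
        ε * (Real.exp (A t) * (Real.exp (2 * K) * (1 / μ))) := add_le_add e2 e3
    _ = _ := by ring

/-- Weak lower semicontinuity of the norm: pair `w(τ)` with `w(t)` for good times `τ` close to `t`.
-/
theorem norm_le_of_ae_norm_le {H : Type*} [NormedAddCommGroup H] [InnerProductSpace ℝ H]
    {w : ℝ → H} (hw : ∀ h : H, ContinuousOn (fun t => inner ℝ (w t) h) (Ici 0)) {s r : ℝ}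
    (hs : 0 ≤ s) (hr : 0 ≤ r) (h : ∀ᵐ t, s < t → ‖w t‖ ≤ r) {t : ℝ} (ht : s < t) : ‖w t‖ ≤ r := by
  by_contra hlt
  rw [not_le] at hlt
  have hcont : ContinuousAt (fun τ => (inner ℝ (w τ) (w t) : ℝ)) t :=
    (hw (w t)).continuousAt (Ici_mem_nhds (hs.trans_lt ht))
  have h1 : r * ‖w t‖ < inner ℝ (w t) (w t) := by
    rw [real_inner_self_eq_norm_mul_norm]
    exact mul_lt_mul_of_pos_right hlt (hr.trans_lt hlt)
  obtain ⟨τ, h4, h2, h3⟩ := (Measure.dense_of_ae h).inter_nhds_nonempty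
    ((eventually_gt_nhds ht).and (hcont.eventually (eventually_gt_nhds h1)))
  have h5 := real_inner_le_norm (w τ) (w t)
  have h6 := mul_le_mul_of_nonneg_right (h4 h2) (norm_nonneg (w t))
  linarith

/-- Of the dissipation `2νG²`, one half absorbs the force by Young's inequality, and the other
dominates `αw²` since `w² ≤ 2δ² + 2η²Kh G²`. -/
theorem dissipation_estimate {ν η Kp Kh δ w G X h e F β m : ℝ} (hν : 0 < ν) (hη : 0 < η)
    (hKp : 0 < Kp) (hKh : 0 < Kh) (hw0 : 0 ≤ w) (hw : w ≤ η * h + e)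
    (he : e ≤ δ) (hh : h ^ 2 ≤ Kh * G ^ 2) (hX : X ^ 2 ≤ Kp * G ^ 2) (hF : F ≤ δ * X)
    (hβ : |β| ≤ m * w ^ 2) :
    2 * (F - ν * G ^ 2 - β) ≤ δ ^ 2 * (Kp / ν + 2 * (ν / (2 * η ^ 2 * Kh))) -
      (ν / (2 * η ^ 2 * Kh) - 2 * m) * w ^ 2 := by
  set α := ν / (2 * η ^ 2 * Kh) with hα
  have hα0 : 0 < α := by positivity
  have h1 : w ^ 2 ≤ 2 * δ ^ 2 + 2 * η ^ 2 * Kh * G ^ 2 := by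
    have a1 : w ^ 2 ≤ (η * h + δ) ^ 2 := by gcongr; linarith
    have a2 : η ^ 2 * h ^ 2 ≤ η ^ 2 * (Kh * G ^ 2) := by gcongr
    nlinarith [sq_nonneg (η * h - δ)]
  have h2 : α * (2 * η ^ 2 * Kh) = ν := by rw [hα]; field_simp
  have h3 : α * w ^ 2 ≤ 2 * α * δ ^ 2 + ν * G ^ 2 := by
    have := mul_le_mul_of_nonneg_left h1 hα0.le
    calc α * w ^ 2 ≤ α * (2 * δ ^ 2 + 2 * η ^ 2 * Kh * G ^ 2) := this
      _ = 2 * α * δ ^ 2 + α * (2 * η ^ 2 * Kh) * G ^ 2 := by ring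
      _ = _ := by rw [h2]
  have h4 : 2 * (δ * X) ≤ δ ^ 2 * (Kp / ν) + ν * G ^ 2 := by
    have a1 : ν / Kp * X ^ 2 ≤ ν / Kp * (Kp * G ^ 2) := by gcongr
    have a2 : ν / Kp * (Kp * G ^ 2) = ν * G ^ 2 := by field_simp
    have a3 : 0 ≤ (ν / Kp) * (X - δ * Kp / ν) ^ 2 := by positivity
    have a4 : (ν / Kp) * (X - δ * Kp / ν) ^ 2 =
        ν / Kp * X ^ 2 - 2 * (δ * X) + δ ^ 2 * (Kp / ν) := by
      field_simp
      ring
    linarith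
  have h5 := (abs_le.1 hβ).1
  nlinarith

theorem exists_ae_of_essTendstoZero {a : ℝ → ℝ} (h : EssTendstoZero a) {δ : ℝ} (hδ : 0 < δ) :
    ∃ t₀, ∀ᵐ t, t₀ ≤ t → a t ≤ δ := by
  have h1 := h.eventually_le_const hδ
  obtain ⟨S, hS, S', hS', hSS'⟩ := mem_inf_iff.1 h1
  obtain ⟨t₀, ht₀⟩ := mem_atTop_sets.1 hS
  refine ⟨t₀, ?_⟩
  filter_upwards [hS'] with t ht h0
  have h2 : t ∈ S ∩ S' := ⟨ht₀ t h0, ht⟩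
  rwa [← hSS'] at h2

/-- `‖φ‖²_{H¹} ≤ K ‖∇φ‖²`, for both versions of the `H¹`-norm. -/
theorem exists_h1_bounds (hΩ : Bornology.IsBounded Ω) :
    ∃ Kp Kh : ℝ, 0 < Kp ∧ 0 < Kh ∧ ∀ φ : SpaceV Ω,
      ‖φ‖ ^ 2 ≤ Kp * ‖gradV φ‖ ^ 2 ∧ h1Norm φ ^ 2 ≤ Kh * ‖gradV φ‖ ^ 2 := by
  obtain ⟨C, hC0, hC⟩ := exists_norm_fieldV_le hΩ
  have hκ : 0 ≤ (volume Ω).toReal ^ (-(1 / 3) : ℝ) := Real.rpow_nonneg ENNReal.toReal_nonneg _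
  refine ⟨C ^ 2 + 1, (volume Ω).toReal ^ (-(1 / 3) : ℝ) * C ^ 2 + 1, by positivity, by positivity,
    fun φ => ?_⟩
  have h1 : ‖fieldV φ‖ ^ 2 ≤ C ^ 2 * ‖gradV φ‖ ^ 2 := by
    rw [← mul_pow]
    gcongr
    exact hC φ
  refine ⟨by rw [norm_sq_spaceV]; linarith, ?_⟩
  rw [h1Norm, Real.sq_sqrt (by positivity)]
  nlinarith [mul_le_mul_of_nonneg_left h1 hκ]

theorem tendsto_norm_sub_of_determining {ν η Kp Kh : ℝ} (hν : 0 < ν) (hη : 0 < η) (hKp : 0 < Kp)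
    (hKh : 0 < Kh) (hΩ : Bornology.IsBounded Ω)
    (hK : ∀ φ : SpaceV Ω, ‖φ‖ ^ 2 ≤ Kp * ‖gradV φ‖ ^ 2 ∧ h1Norm φ ^ 2 ≤ Kh * ‖gradV φ‖ ^ 2)
    {f g : ℝ → VDual Ω} (hf : IsForcing f) (hg : IsForcing g)
    (hfg : EssTendstoZero (fun t => ‖f t - g t‖)) {u v : ℝ → SpaceH Ω} {uV vV : ℝ → SpaceV Ω}
    (hu : IsWeakSolution ν f u uV) (hv : IsWeakSolution ν g v vV) (hE : EnergyInequality ν g v vV)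
    (hD : meanGradSup uV < ⊤) {R : SpaceV Ω → L2 Ω}
    (hR : ∀ φ : SpaceV Ω, ‖fieldV φ - R φ‖ ≤ η * h1Norm φ)
    (hRuv : EssTendstoZero (fun t => ‖R (uV t - vV t)‖))
    (hlt : 2 * (meanGradSup uV).toReal < ν / (2 * η ^ 2 * Kh)) :
    Tendsto (fun t => ‖u t - v t‖) atTop (𝓝 0) := by
  set α := ν / (2 * η ^ 2 * Kh) with hα
  have hα0 : 0 < α := by positivity
  obtain ⟨b, hb, hadv⟩ := exists_advectionForm hΩ
  obtain ⟨T, κ, t₀, hT, hκ0, hκ, ht₀, hmean⟩ :=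
    exists_lintegral_gradSup_le (A := α / 2) hD (by linarith)
  have hμ : 0 < α - 2 * κ := by linarith
  rw [Metric.tendsto_atTop]
  intro r hr
  set L := Kp / ν + 2 * α with hL
  have hL0 : 0 < L := by positivity
  -- `δ` bounds the late values of `‖f - g‖` and `‖R w‖`. It is chosen so that the stationary part
  -- of the Grönwall bound uses at most half of `(r / 2) ^ 2`; the decaying part takes the other
  -- half.
  obtain ⟨δ, hδ0, hδ⟩ : ∃ δ : ℝ, 0 < δ ∧
      Real.exp (2 * (κ * T)) * (δ ^ 2 * L / (α - 2 * κ)) ≤ (r / 2) ^ 2 / 2 := by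
    refine ⟨Real.sqrt ((r / 2) ^ 2 / 2 / (Real.exp (2 * (κ * T)) * (L / (α - 2 * κ)))),
      by positivity, ?_⟩
    rw [Real.sq_sqrt (by positivity)]
    field_simp
    exact le_rfl
  obtain ⟨t₁, ht₁⟩ := exists_ae_of_essTendstoZero hfg hδ0
  obtain ⟨t₂, ht₂⟩ := exists_ae_of_essTendstoZero hRuv hδ0
  set c := max t₀ (max t₁ t₂) with hc_def
  have hc0 : 0 < c := ht₀.trans_le (le_max_left _ _)
  have hct₁ : t₁ ≤ c := (le_max_left _ _).trans (le_max_right _ _)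
  have hct₂ : t₂ ≤ c := (le_max_right _ _).trans (le_max_right _ _)
  have hlint : ∀ s t, c ≤ s → s ≤ t → ∫⁻ τ in Ioc s t, gradSup (uV τ) ≤
      ENNReal.ofReal (κ * (t - s) + κ * T) := fun s t h1 h2 =>
    lintegral_Ioc_le_of_mean hT hκ0 hmean ((le_max_left _ _).trans h1) h2
  have hfin : ∀ d, ∫⁻ τ in Ioo c d, gradSup (uV τ) ≠ ⊤ := by
    intro d
    rcases le_or_gt d c with h | h
    · simp [Ioo_eq_empty (not_lt.2 h)]
    · exact ((lintegral_mono_set Ioo_subset_Ioc_self).trans (hlint c d le_rfl h.le)).trans_lt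
        ENNReal.ofReal_lt_top |>.ne
  obtain ⟨u', hu'⟩ := hu.exists_evolution hb hf
  obtain ⟨v', hv'⟩ := hv.exists_evolution hb hg
  have hMm : ∀ d, AEMeasurable (fun τ => gradSup (uV τ)) (volume.restrict (Ioo c d)) := fun d =>
    hadv.aemeasurable (hu'.memLp_Ioo hc0 d).1
  set m : ℝ → ℝ := fun τ => (gradSup (uV τ)).toReal with hm_def
  have hm : ∀ d, IntegrableOn m (Ioo c d) := fun d =>
    integrable_toReal_of_lintegral_ne_top (hMm d) (hfin d)
  have hwm : ∀ d, AEStronglyMeasurable (fun t => u t - v t) (volume.restrict (Ioo c d)) := by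
    intro d
    have hpos : Ioo c d ⊆ Ioi 0 := fun τ h => hc0.trans h.1
    exact (aestronglyMeasurable_of_ae_eq measurableSet_Ioo hpos hu'.ae_eq (hu'.memLp_Ioo hc0 d).1).sub
      (aestronglyMeasurable_of_ae_eq measurableSet_Ioo hpos hv'.ae_eq (hv'.memLp_Ioo hc0 d).1)
  have hwc : ∀ h : SpaceH Ω, ContinuousOn (fun t => inner ℝ (u t - v t) h) (Ici 0) := by
    intro h
    simp_rw [inner_sub_left]
    exact (hu.weaklyContinuous h).sub (hv.weaklyContinuous h)
  set y : ℝ → ℝ := fun t => ‖u t - v t‖ ^ 2 with hy_def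
  have hym : ∀ d, AEStronglyMeasurable y (volume.restrict (Ioo c d)) := fun d =>
    (hwm d).norm.pow 2
  have hY : ∀ d, ∃ Y, ∀ τ ∈ Ioo c d, 0 ≤ y τ ∧ y τ ≤ Y := by
    intro d
    obtain ⟨C, hC0, hC⟩ := exists_norm_le_of_weaklyContinuous hwc d
    refine ⟨C ^ 2, fun τ hτ => ⟨by positivity, ?_⟩⟩
    have := hC τ ⟨(hc0.trans hτ.1).le, hτ.2.le⟩
    simp only [hy_def]
    gcongr
  have hpoint : ∀ᵐ τ, c < τ → gradSup (uV τ) < ⊤ →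
      2 * ((f τ - g τ) (uV τ - vV τ) - ν * ‖gradV (uV τ - vV τ)‖ ^ 2
        - b (uV τ - vV τ) (uV τ) (uV τ - vV τ)) ≤ δ ^ 2 * L - (α - 2 * m τ) * y τ := by
    filter_upwards [hu'.ae_eq, hv'.ae_eq, ht₁, ht₂] with τ h1 h2 h3 h4 hcτ hfin
    have hw : ‖fieldV (uV τ - vV τ)‖ = ‖u τ - v τ‖ := by
      rw [← norm_inclusionH, map_sub, h1 (hc0.trans hcτ), h2 (hc0.trans hcτ)]
    have hbd := hadv.bound (uV τ - vV τ) (uV τ) (uV τ - vV τ) hfin.ne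
    rw [norm_inclusionH, hw, mul_assoc, ← sq] at hbd
    refine dissipation_estimate hν hη hKp hKh (norm_nonneg _)
      ?_ (h4 (hct₂.trans hcτ.le)) (hK _).2 (hK _).1 ?_ hbd
    · rw [← hw]
      have h5 := norm_add_le (fieldV (uV τ - vV τ) - R (uV τ - vV τ)) (R (uV τ - vV τ))
      rw [sub_add_cancel] at h5
      exact h5.trans (add_le_add (hR _) le_rfl)
    · refine (le_abs_self _).trans (((f τ - g τ).le_opNorm _).trans ?_)
      gcongr
      exact h3 (hct₁.trans hcτ.le)
  have H : ∀ d, AEPairs c d fun s t => y t ≤ y s +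
      ∫ τ in s..t, (δ ^ 2 * L - (α - 2 * m τ) * y τ) := by
    intro d
    obtain ⟨hint, hpairs⟩ := difference_energy hb hadv hf hg hu hv hE hc0 (hfin d)
    have hfin' : ∀ᵐ τ, τ ∈ Ioo c d → gradSup (uV τ) < ⊤ :=
      (ae_restrict_iff' measurableSet_Ioo).1 (ae_lt_top' (hMm d) (hfin d))
    obtain ⟨Y, hYd⟩ := hY d
    have hright : IntegrableOn (fun τ => δ ^ 2 * L - (α - 2 * m τ) * y τ) (Ioo c d) := by
      refine Integrable.sub (integrableOn_const (by simp)) ?_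
      refine Integrable.mul_bdd (c := Y)
        (Integrable.sub (integrableOn_const (by simp)) ((hm d).const_mul 2)) (hym d) ?_
      refine (ae_restrict_iff' measurableSet_Ioo).2 (Eventually.of_forall fun τ hτ => ?_)
      rw [Real.norm_of_nonneg (hYd τ hτ).1]
      exact (hYd τ hτ).2
    refine hpairs.mono fun s t hs hst ht h => ?_
    have i1 := intervalIntegrable_of_integrableOn_Ioo hint hs.le hst.le ht.le
    have i2 := intervalIntegrable_of_integrableOn_Ioo hright hs.le hst.le ht.le
    have h2 : ∫ τ in s..t, 2 * ((f τ - g τ) (uV τ - vV τ) - ν * ‖gradV (uV τ - vV τ)‖ ^ 2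
        - b (uV τ - vV τ) (uV τ) (uV τ - vV τ)) ≤
        ∫ τ in s..t, (δ ^ 2 * L - (α - 2 * m τ) * y τ) := by
      rw [intervalIntegral.integral_of_le hst.le, intervalIntegral.integral_of_le hst.le]
      refine setIntegral_mono_on_ae (i1.const_mul 2).1 i2.1 measurableSet_Ioc ?_
      filter_upwards [hpoint, hfin'] with τ h3 h4 hτ
      exact h3 (hs.trans hτ.1) (h4 ⟨hs.trans hτ.1, hτ.2.trans_lt ht⟩)
    rw [intervalIntegral.integral_const_mul] at h2
    simp only [hy_def] at h2 ⊢
    linarith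
  have hmeanR : ∀ s t, c ≤ s → s ≤ t → ∫ τ in s..t, m τ ≤ κ * (t - s) + κ * T := by
    intro s t h1 h2
    have h3 : 0 ≤ κ * (t - s) + κ * T :=
      add_nonneg (mul_nonneg hκ0 (by linarith)) (mul_nonneg hκ0 hT.le)
    have hms : AEMeasurable (fun τ => gradSup (uV τ)) (volume.restrict (Ioc s t)) := by
      exact (hMm (t + 1)).mono_measure (Measure.restrict_mono
        (show Ioc s t ⊆ Ioo c (t + 1) from fun τ h => ⟨h1.trans_lt h.1, by linarith [h.2]⟩) le_rfl)
    rw [intervalIntegral.integral_of_le h2, integral_toReal hms]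
    · exact ENNReal.toReal_le_of_le_ofReal h3 (hlint s t h1 h2)
    · exact ae_lt_top' hms ((hlint s t h1 h2).trans_lt ENNReal.ofReal_lt_top).ne
  have hdecay := decay_of_mean (y := y) (m := m) (c := c) (α := α) (κ := κ) (K := κ * T)
    (ε := δ ^ 2 * L) (by linarith) (by positivity) hm hmeanR hym hY H
  -- One good starting time suffices: its contribution decays exponentially.
  obtain ⟨s, hcs, hs⟩ : ∃ s, c < s ∧ ∀ᵐ t, s < t → y t ≤ Real.exp (2 * (κ * T)) *
      (Real.exp (-((α - 2 * κ) * (t - s))) * y s + δ ^ 2 * L / (α - 2 * κ)) := by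
    obtain ⟨s, h1, h2⟩ := (Measure.dense_of_ae hdecay).inter_nhds_nonempty
      (Ioi_mem_nhds (lt_add_one c))
    exact ⟨s, h2, h1 h2⟩
  have hlim : Tendsto (fun t => Real.exp (2 * (κ * T)) *
      (Real.exp (-((α - 2 * κ) * (t - s))) * y s)) atTop (𝓝 0) := by
    have h1 : Tendsto (fun t => (α - 2 * κ) * (t - s)) atTop atTop :=
      (tendsto_atTop_add_const_right _ (-s) tendsto_id).const_mul_atTop hμ
    have h2 := ((Real.tendsto_exp_neg_atTop_nhds_zero.comp h1).mul_const (y s)).const_mul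
      (Real.exp (2 * (κ * T)))
    simpa using h2
  have hr2 : 0 < (r / 2) ^ 2 / 2 := by positivity
  obtain ⟨s₁, hs₁⟩ := eventually_atTop.1 (hlim.eventually_le_const hr2)
  refine ⟨max s s₁ + 1, fun t ht => ?_⟩
  have hsm : 0 ≤ max s s₁ := (hc0.trans hcs).le.trans (le_max_left _ _)
  have hfinal : ∀ᵐ t, max s s₁ < t → ‖u t - v t‖ ≤ r / 2 := by
    filter_upwards [hs] with t h1 h2
    have h3 := h1 ((le_max_left _ _).trans_lt h2)
    have h4 := hs₁ t ((le_max_right _ _).trans h2.le)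
    rw [mul_add] at h3
    refine le_of_sq_le_sq ?_ (by positivity)
    change y t ≤ _
    linarith
  have := norm_le_of_ae_norm_le hwc hsm (by positivity) hfinal (t := t) (by linarith)
  rw [Real.dist_eq, sub_zero, abs_norm]
  linarith

end NSE

/-! ### The criterion on the dimension `N`. -/

open NSE
theorem theorem5p1 (Ω : Set E3) (hΩ_open : IsOpen Ω) (hΩ_bdd : Bornology.IsBounded Ω)
    (hΩ_lip : HasLipschitzBoundary Ω) (γ C₁ : ℝ) (hγ : 0 < γ) (hC₁ : 0 < C₁) :
    ∃ C : ℝ, 0 < C ∧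
      ∀ (ν : ℝ), 0 < ν →
      ∀ (f g : ℝ → VDual Ω), IsForcing f → IsForcing g →
        EssTendstoZero (fun t => ‖f t - g t‖) →
      ∀ (u v : ℝ → SpaceH Ω) (uV vV : ℝ → SpaceV Ω),
        IsWeakSolution ν f u uV → IsWeakSolution ν g v vV → EnergyInequality ν g v vV →
        meanGradSup uV < ⊤ →
      ∀ (N : ℕ) (VN : Submodule ℝ (L2 Ω)) (RN : SpaceV Ω →ₗ[ℝ] L2 Ω),
        FiniteDimensional ℝ VN → Module.finrank ℝ VN = N → (∀ φ, RN φ ∈ VN) →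
        (∀ φ : SpaceV Ω, ‖fieldV φ - RN φ‖ ≤ C₁ * (N : ℝ) ^ (-γ) * h1Norm φ) →
        EssTendstoZero (fun t => ‖RN (uV t - vV t)‖) →
        C * ((1 / ν) * (meanGradSup uV).toReal) ^ (1 / (2 * γ)) < (N : ℝ) →
        Tendsto (fun t => ‖u t - v t‖) atTop (𝓝 0) := by
  obtain ⟨Kp, Kh, hKp, hKh, hK⟩ := exists_h1_bounds hΩ_bdd
  -- With `η = C₁ N^{-γ}`, the condition `2D < ν / (2η²Kh)` reads `4 C₁² Kh D / ν < N^{2γ}`.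
  refine ⟨(4 * C₁ ^ 2 * Kh) ^ (1 / (2 * γ)), by positivity, ?_⟩
  intro ν hν f g hf hg hfg u v uV vV hu hv hE hD N VN RN _ _ _ hR hRuv hN
  have hD0 : 0 ≤ (meanGradSup uV).toReal := ENNReal.toReal_nonneg
  -- Strictness in the bound on `N` excludes `N = 0` even if `D = 0`.
  have hN0 : (0 : ℝ) < N := lt_of_le_of_lt (by positivity) hN
  have hη : 0 < C₁ * (N : ℝ) ^ (-γ) := by positivity
  refine tendsto_norm_sub_of_determining hν hη hKp hKh hΩ_bdd hK hf hg hfg hu hv hE hD hR hRuv ?_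
  rw [← Real.mul_rpow (by positivity) (by positivity)] at hN
  have h1 := Real.rpow_lt_rpow (by positivity) hN (show 0 < 2 * γ by positivity)
  rw [← Real.rpow_mul (by positivity), one_div_mul_cancel (by positivity), Real.rpow_one] at h1
  have h2 : ((N : ℝ) ^ (-γ)) ^ 2 * (N : ℝ) ^ (2 * γ) = 1 := by
    rw [← Real.rpow_natCast, ← Real.rpow_mul hN0.le, ← Real.rpow_add hN0]
    norm_num
    ring_nf
    simp
  rw [lt_div_iff₀ (by positivity)]
  have h3 : 0 < ((N : ℝ) ^ (-γ)) ^ 2 := by positivity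
  have h4 := mul_lt_mul_of_pos_left h1 (mul_pos hν h3)
  calc _ = ν * ((N : ℝ) ^ (-γ)) ^ 2 * (4 * C₁ ^ 2 * Kh * (1 / ν * (meanGradSup uV).toReal)) := by
        field_simp
        ring
    _ < _ := h4
    _ = ν * (((N : ℝ) ^ (-γ)) ^ 2 * (N : ℝ) ^ (2 * γ)) := by ring
    _ = ν := by rw [h2, mul_one]
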